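/- Let $(X(t))_{t\in\mathbb{R}}$ be a real, centered Gaussian process with stationary increments, and let $V(h)=\frac12\mathbb{E}[(X(t+h)-X(t))^2]$ be its semi-variogram. Let $0<\alpha\le 1$ and $\delta_n=n^{-\alpha}$ (the infill situation is $\alpha=1$, the mixed situation is $0<\alpha<1$). Let $D\ge 0$ be an integer and let $C,s$ be real numbers. Assume the following. ($\mathcal H_0$) $V$ is $C^\infty$ on $(0,+\infty)$. ($\mathcal H_1$) $C>0$, $0<s<2$, $V$ is $2D$ times differentiable on $\mathbb{R}$, and the function $r$ defined by $V^{(2D)}(h)=V^{(2D)}(0)+C(-1)^D|h|^s+r(h)$, $h\in\mathbb{R}$, satisfies $r(h)=o(|h|^s)$ as $h\to0$. If $\alpha<1$, there is moreover a constant $K$ with $|r(h)|\le K|h|^s$ for all $|h|>1$. ($\mathcal H_2$) Put $d=2$ if $s<3/2$ and $d=3$ if $s\ge 3/2$. There are $\beta$ with $s-d<\beta<-1/2$ and a constant $K$ such that $|r^{(d)}(h)|\le K|h|^\beta$ for all $0<|h|<1$ if $\alpha=1$, and for all $h\ne0$ if $\alpha<1$. Consider finitely supported non-zero sequences $a=(a_j)_{j\in\mathbb{Z}}$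 of real numbers with zero sum whose first non-zero element is $a_0$. Let $L(a)$ be the length of $a$, so that the last non-zero element is $a_{L(a)-1}$, and let $M(a)$ be its order, i.e. the least $k$ with $\sum_j a_jj^k\neq0$. Put $\Delta_{a,i}(f)=\sum_j a_j f((i+j)\delta_n)$ and $V_{a,n}=\sum_{i=1}^{n-L(a)+1}(\Delta_{a,i}(X))^2$. For two such sequences $a,a'$ let $(a*a')_j=\sum_{k-l=j}a_ka'_l$. For a finitely supported sequence $b$, an integer $i$, a scale $\delta$ and a function $f$, put $$R(i,\delta,q,f,b)=-\sum_j b_j j^q\int_0^1\frac{(1-\eta)^{q-1}}{(q-1)!}f((i+j\eta)\delta)\,d\eta\quad(q\ge1),\qquad R(i,\delta,0,f,b)=-\sum_j b_jf((i+j)\delta).$$ Let $a,a'$ be two such sequences with $\min(M(a),M(a'))>D+\frac s2+\frac14$. Then the series $\sum_{i\in\mathbb{Z}}R^2(i,1,2D,|\cdot|^s,a*a')$ converges, and as $n\to\infty$ $$\mathrm{Cov}(V_{a,n},V_{a',n})=2nC^2\delta_n^{4D+2s}\left[\sum_{i\in\mathbb{Z}}R^2(i,1,2D,|\cdot|^s,a*a')\right](1+o(1)).$$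 -/

import Mathlib

open MeasureTheory ProbabilityTheory Filter Topology Asymptotics

noncomputable section

namespace QuadVar

/-! ### The process and its semi-variogram -/

/-- The real process `X` indexed by `ℝ` has stationary increments: for every `t`, the process
`(X (t + h) - X t)_h` has the same finite-dimensional distributions as `(X h - X 0)_h`. -/
def HasStationaryIncrements {Ω : Type*} [MeasurableSpace Ω] (X : ℝ → Ω → ℝ) (P : Measure Ω) :
    Prop :=
  ∀ (t : ℝ) (I : Finset ℝ),
    IdentDistrib (fun ω (h : I) => X (t + h) ω - X t ω) (fun ω (h : I) => X h ω - X 0 ω) P P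

/-- The semi-variogram `V h = (1/2) E[(X (t + h) - X t)^2]`. Under stationary increments the right
hand side does not depend on `t`, so it is evaluated at `t = 0`. -/
def semivariogram {Ω : Type*} [MeasurableSpace Ω] (X : ℝ → Ω → ℝ) (P : Measure Ω) (h : ℝ) : ℝ :=
  (1 / 2) * ∫ ω, (X h ω - X 0 ω) ^ 2 ∂P

/-! ### The assumptions on the semi-variogram

The parameter `α` is the exponent of the mesh `δ_n = n ^ (-α)`: the infill situation is `α = 1`, the
mixed situation is `0 < α < 1`. -/

/-- The remainder `r` in `V^(2D)(h) = V^(2D)(0) + C (-1)^D |h|^s + r(h)`. -/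
def remainder (V : ℝ → ℝ) (D : ℕ) (C s : ℝ) (h : ℝ) : ℝ :=
  iteratedDeriv (2 * D) V h - iteratedDeriv (2 * D) V 0 - C * (-1) ^ D * |h| ^ s

/-- `V` is infinitely differentiable on the open half-line `(0, ∞)`. -/
def H0 (V : ℝ → ℝ) : Prop := ContDiffOn ℝ ((⊤ : ℕ∞) : WithTop ℕ∞) V (Set.Ioi 0)

/-- `V` is `2D` times differentiable on `ℝ`, and `V^(2D)` has the expansion above at the origin,
with `C > 0`, `0 < s < 2` and `r(h) = o(|h|^s)`; in the mixed situation, moreover,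
`|r(h)| ≤ K |h|^s` for `|h| > 1`. -/
structure H1 (V : ℝ → ℝ) (α : ℝ) (D : ℕ) (C s : ℝ) : Prop where
  differentiable : ∀ m < 2 * D, Differentiable ℝ (iteratedDeriv m V)
  C_pos : 0 < C
  s_pos : 0 < s
  s_lt : s < 2
  isLittleO : remainder V D C s =o[𝓝 0] fun h : ℝ => |h| ^ s
  bound : α < 1 → ∃ K : ℝ, ∀ h : ℝ, 1 < |h| → |remainder V D C s h| ≤ K * |h| ^ s

/-- The number of derivatives of `r` that are controlled: `2` if `s < 3/2`, and `3` if
`s ≥ 3/2`. -/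
def derivOrder (s : ℝ) : ℕ := if s < 3 / 2 then 2 else 3

/-- With `d = derivOrder s`: for some `β` with `s - d < β < -1/2` one has
`|r^(d)(h)| ≤ K |h|^β`, for `0 < |h| < 1` in the infill situation and for all `h ≠ 0` in the mixed
situation. -/
def H2 (V : ℝ → ℝ) (α : ℝ) (D : ℕ) (C s : ℝ) : Prop :=
  ∃ β : ℝ, s - derivOrder s < β ∧ β < -1 / 2 ∧
    ∃ K : ℝ, ∀ h : ℝ, h ≠ 0 → (α = 1 → |h| < 1) →
      |iteratedDeriv (derivOrder s) (remainder V D C s) h| ≤ K * |h| ^ β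

/-! ### Sequences and discrete differences -/

/-- A finitely supported real sequence, not zero, whose first non-zero element has index `0`, and
whose sum is zero. -/
structure IsVariationSequence (a : ℤ →₀ ℝ) : Prop where
  apply_zero : a 0 ≠ 0
  apply_neg : ∀ j : ℤ, j < 0 → a j = 0
  sum_eq_zero : ∑ j ∈ a.support, a j = 0

/-- The length `L(a)` of a sequence whose first non-zero element is `a 0`: one plus the index of
its last non-zero element. -/
def length (a : ℤ →₀ ℝ) : ℕ := a.support.sup Int.toNat + 1

/-- The order `M(a)`: the least `k` such that the `k`-th moment `∑ j, a j * j ^ k` is not zero. -/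
def order (a : ℤ →₀ ℝ) : ℕ := sInf {k : ℕ | ∑ j ∈ a.support, a j * (j : ℝ) ^ k ≠ 0}

/-- The convolution `(a * a')_j = ∑_{k - l = j} a_k a'_l`. -/
def conv (a a' : ℤ →₀ ℝ) : ℤ →₀ ℝ :=
  ∑ k ∈ a.support, ∑ l ∈ a'.support, Finsupp.single (k - l) (a k * a' l)

/-- The discrete `a`-difference `Δ_{a,i}(f) = ∑ j, a j * f ((i + j) δ)` at scale `δ`. -/
def diff (δ : ℝ) (a : ℤ →₀ ℝ) (i : ℤ) (f : ℝ → ℝ) : ℝ :=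
  ∑ j ∈ a.support, a j * f (((i : ℝ) + j) * δ)

/-- `R(i, δ, q, f, a) = - ∑ j, a j * j^q * ∫_0^1 (1 - η)^(q-1) / (q-1)! * f ((i + j η) δ) dη` for
`q ≥ 1`, and `R(i, δ, 0, f, a) = - Δ_{a,i}(f)`. -/
def R (i : ℤ) (δ : ℝ) (q : ℕ) (f : ℝ → ℝ) (a : ℤ →₀ ℝ) : ℝ :=
  match q with
  | 0 => -diff δ a i f
  | p + 1 => -∑ j ∈ a.support, a j * (j : ℝ) ^ (p + 1) *
      ∫ η in (0 : ℝ)..1, (1 - η) ^ p / (p.factorial : ℝ) * f (((i : ℝ) + j * η) * δ)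

/-- The quadratic `a`-variation `V_{a,n} = ∑_{i=1}^{n'} Δ_{a,i}(X)^2`, where `n' = n - L(a) + 1`
and where the difference is taken at scale `δ_n = n ^ (-α)`; the sum is empty if `n' ≤ 0`. -/
def quadVariation {Ω : Type*} (X : ℝ → Ω → ℝ) (α : ℝ) (a : ℤ →₀ ℝ) (n : ℕ) (ω : Ω) : ℝ :=
  ∑ i ∈ Finset.Icc 1 (n + 1 - length a), (diff ((n : ℝ) ^ (-α)) a i fun t => X t ω) ^ 2

end QuadVar

end

namespace QuadVar

/-! ### Gaussian computations -/

/-! For centered jointly Gaussian `Z`, `W` one has `Cov(Z², W²) = 2 E[ZW]²`. Because `a` and `a'`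
sum to zero, the covariance of two differences of `X` is `-Δ_{a*a', i-i'}(V)`
(`integral_diff_mul_diff`). The covariance of the variations is thus a sum over lags `k = i - i'` of
`2 (Δ_{a*a',k} V)²`, weighted by the number of pairs with that lag.

The moments of `a * a'` below `M(a) + M(a')` vanish, so Taylor's formula with integral remainder can
be iterated without leaving polynomial terms. The first `2D` steps (`neg_diff_eq`) give `-Δ_k V =
δ^(2D) (C (-1)^D δ^s R_k + R_k(δ, r))`, where `R_k` is the limiting remainder for `|·|^s`. For fixed
`k`, `r = o(|h|^s)` makes the second term negligible, and the pair count divided by `n` tends to 1.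
After division by `n δ^(4D+2s)` each lag therefore contributes `2 C² R_k²` in the limit.

Limit and sum are exchanged by dominated convergence (`tendsto_tsum_pairCount`). For large `|k|` the
segments avoid the origin, so `d` more Taylor steps are allowed; they bound both terms, divided by
`δ^s`, by a multiple of `|k|^β` with `β < -1/2`, which is square summable.

An equivalent also needs a nonzero limit (`exists_R_abs_rpow_ne_zero`). If every `R_k` vanished, the
`a * a'`-differences of `|x|^(2D+s)` would vanish at all integers. For `s ≠ 1`, expanding at
infinity then kills every moment of `a * a'`, whereas the one of order `M(a) + M(a')` is not zero;
for `s = 1`, comparison with the polynomial `x^(2D+1)` gives the contradiction. -/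

lemma integral_pow_four_gaussianReal (v : NNReal) :
    ∫ x, x ^ 4 ∂(gaussianReal 0 v) = 3 * (v : ℝ) ^ 2 := by
  have h := iteratedDeriv_mgf_zero (X := id) (μ := gaussianReal 0 v) (by simp) 4
  have e : ∀ t : ℝ, HasDerivAt (fun t : ℝ => Real.exp (v * t ^ 2 / 2))
      (v * t * Real.exp (v * t ^ 2 / 2)) t := fun t => by
    have := ((((hasDerivAt_id t).pow 2).const_mul (v : ℝ)).div_const 2).exp
    refine this.congr_deriv ?_
    simp; ring
  have d1 : deriv (fun t : ℝ => Real.exp (v * t ^ 2 / 2)) =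
      fun t => v * t * Real.exp (v * t ^ 2 / 2) := funext fun t => (e t).deriv
  have d2 : deriv (fun t : ℝ => v * t * Real.exp (v * t ^ 2 / 2)) =
      fun t => (v + v ^ 2 * t ^ 2) * Real.exp (v * t ^ 2 / 2) := funext fun t => by
    have := (((hasDerivAt_id t).const_mul (v : ℝ)).mul (e t)).deriv
    simp only [Pi.mul_def, id] at this
    rw [this]; ring
  have d3 : deriv (fun t : ℝ => (v + v ^ 2 * t ^ 2) * Real.exp (v * t ^ 2 / 2)) =
      fun t => (3 * v ^ 2 * t + v ^ 3 * t ^ 3) * Real.exp (v * t ^ 2 / 2) := funext fun t => by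
    have := (((((hasDerivAt_id t).pow 2).const_mul ((v : ℝ) ^ 2)).const_add (v : ℝ)).mul (e t)).deriv
    simp only [Pi.mul_def, Pi.pow_apply, id] at this
    rw [this]; push_cast; ring
  have d4 : deriv (fun t : ℝ => (3 * v ^ 2 * t + v ^ 3 * t ^ 3) * Real.exp (v * t ^ 2 / 2)) 0 =
      3 * (v : ℝ) ^ 2 := by
    have := ((((hasDerivAt_id (0 : ℝ)).const_mul (3 * (v : ℝ) ^ 2)).add
      (((hasDerivAt_id (0 : ℝ)).pow 3).const_mul ((v : ℝ) ^ 3))).mul (e 0)).deriv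
    simp only [Pi.mul_def, Pi.add_apply, Pi.pow_apply, id] at this
    rw [this]; simp
  simp only [id_def, Pi.pow_def] at h
  have hm : mgf id (gaussianReal 0 v) = fun t : ℝ => Real.exp (v * t ^ 2 / 2) := by
    simpa using! mgf_fun_id_gaussianReal (μ := 0) (v := v)
  rw [← h, hm]
  simp only [iteratedDeriv_succ, iteratedDeriv_zero, d1, d2, d3, d4]

variable {Ω : Type*} [MeasurableSpace Ω] {P : Measure Ω}

lemma integral_pow_four_of_hasGaussianLaw {W : Ω → ℝ} (hW : HasGaussianLaw W P)
    (hc : ∫ ω, W ω ∂P = 0) : ∫ ω, W ω ^ 4 ∂P = 3 * (∫ ω, W ω ^ 2 ∂P) ^ 2 := by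
  have := hW.isProbabilityMeasure
  have h1 := hW.map_eq_gaussianReal
  rw [hc] at h1
  have h2 : Var[W; P] = ∫ ω, W ω ^ 2 ∂P := by
    rw [variance_of_integral_eq_zero hW.aemeasurable hc]
  have h3 := integral_pow_four_gaussianReal (Var[W; P].toNNReal)
  rw [← h1, integral_map hW.aemeasurable (by fun_prop), Real.coe_toNNReal _ (variance_nonneg _ _),
    h2] at h3
  exact h3

lemma integrable_pow_four_of_hasGaussianLaw {U : Ω → ℝ} (hU : HasGaussianLaw U P) :
    Integrable (fun ω => U ω ^ 4) P := by
  have := hU.isProbabilityMeasure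
  refine ((hU.memLp (p := 4) (by simp)).integrable_norm_pow (by simp)).congr
    (ae_of_all _ fun ω => ?_)
  have : Even 4 := by decide
  simp [this.pow_abs]

lemma memLp_sq_of_hasGaussianLaw {U : Ω → ℝ} (hU : HasGaussianLaw U P) :
    MemLp (fun ω => U ω ^ 2) 2 P := by
  rw [memLp_two_iff_integrable_sq hU.memLp_two.integrable_sq.aestronglyMeasurable]
  exact (integrable_pow_four_of_hasGaussianLaw hU).congr (ae_of_all _ fun ω => by ring)

/-- Polarization reduces this to one-dimensional fourth moments: `(Z+W)⁴ + (Z-W)⁴ = 2Z⁴ + 12Z²W² +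
2W⁴`, and `E U⁴ = 3 (E U²)²` for each of `Z`, `W`, `Z ± W`. -/
lemma covariance_sq_sq_of_hasGaussianLaw {Z W : Ω → ℝ} (hZ : HasGaussianLaw Z P)
    (hW : HasGaussianLaw W P) (hadd : HasGaussianLaw (fun ω => Z ω + W ω) P)
    (hsub : HasGaussianLaw (fun ω => Z ω - W ω) P)
    (hZ0 : ∫ ω, Z ω ∂P = 0) (hW0 : ∫ ω, W ω ∂P = 0) :
    covariance (fun ω => Z ω ^ 2) (fun ω => W ω ^ 2) P = 2 * (∫ ω, Z ω * W ω ∂P) ^ 2 := by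
  have := hW.isProbabilityMeasure
  have m4 {U : Ω → ℝ} (hU : HasGaussianLaw U P) := integrable_pow_four_of_hasGaussianLaw hU
  have m2 {U : Ω → ℝ} (hU : HasGaussianLaw U P) := hU.memLp_two.integrable_sq
  have q2 {U : Ω → ℝ} (hU : HasGaussianLaw U P) := memLp_sq_of_hasGaussianLaw hU
  have iZW : Integrable (fun ω => Z ω * W ω) P := hZ.memLp_two.integrable_mul hW.memLp_two
  have iZW2 : Integrable (fun ω => Z ω ^ 2 * W ω ^ 2) P := (q2 hZ).integrable_mul (q2 hW)
  have iZ := hZ.integrable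
  have iW := hW.integrable
  have ea := integral_pow_four_of_hasGaussianLaw hadd (by rw [integral_add iZ iW, hZ0, hW0, add_zero])
  have es := integral_pow_four_of_hasGaussianLaw hsub (by rw [integral_sub iZ iW, hZ0, hW0, sub_zero])
  have eZ := integral_pow_four_of_hasGaussianLaw hZ hZ0
  have eW := integral_pow_four_of_hasGaussianLaw hW hW0
  have sa : ∫ ω, (Z ω + W ω) ^ 2 ∂P =
      ∫ ω, Z ω ^ 2 ∂P + 2 * ∫ ω, Z ω * W ω ∂P + ∫ ω, W ω ^ 2 ∂P := by
    rw [← integral_const_mul, ← integral_add (m2 hZ) (iZW.const_mul 2),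
      ← integral_add (show Integrable (fun ω => Z ω ^ 2 + 2 * (Z ω * W ω)) P from
        (m2 hZ).add (iZW.const_mul 2)) (m2 hW)]
    congr 1; ext ω; ring
  have ss : ∫ ω, (Z ω - W ω) ^ 2 ∂P =
      ∫ ω, Z ω ^ 2 ∂P - 2 * ∫ ω, Z ω * W ω ∂P + ∫ ω, W ω ^ 2 ∂P := by
    rw [← integral_const_mul, ← integral_sub (m2 hZ) (iZW.const_mul 2),
      ← integral_add (show Integrable (fun ω => Z ω ^ 2 - 2 * (Z ω * W ω)) P from
        (m2 hZ).sub (iZW.const_mul 2)) (m2 hW)]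
    congr 1; ext ω; ring
  have s4 : ∫ ω, (Z ω + W ω) ^ 4 ∂P + ∫ ω, (Z ω - W ω) ^ 4 ∂P =
      2 * ∫ ω, Z ω ^ 4 ∂P + 12 * ∫ ω, Z ω ^ 2 * W ω ^ 2 ∂P + 2 * ∫ ω, W ω ^ 4 ∂P := by
    rw [← integral_const_mul, ← integral_const_mul, ← integral_const_mul,
      ← integral_add (m4 hadd) (m4 hsub),
      ← integral_add ((m4 hZ).const_mul 2) (iZW2.const_mul 12),
      ← integral_add (show Integrable (fun ω => 2 * Z ω ^ 4 + 12 * (Z ω ^ 2 * W ω ^ 2)) P from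
        ((m4 hZ).const_mul 2).add (iZW2.const_mul 12)) ((m4 hW).const_mul 2)]
    congr 1; ext ω; ring
  rw [covariance_eq_sub (q2 hZ) (q2 hW)]
  simp only [Pi.mul_apply]
  rw [ea, es, eZ, eW, sa, ss] at s4
  linarith

variable {X : ℝ → Ω → ℝ}

lemma hasGaussianLaw_linearCombination (hX : IsGaussianProcess X P) {ι : Type*} (I : Finset ι)
    (c : ι → ℝ) (t : ι → ℝ) : HasGaussianLaw (fun ω => ∑ i ∈ I, c i * X (t i) ω) P := by
  classical
  let L : ((I.image t) → ℝ) →L[ℝ] ℝ :=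
    ∑ i ∈ I.attach, c i • ContinuousLinearMap.proj (R := ℝ) (φ := fun _ : I.image t => ℝ)
      ⟨t i, Finset.mem_image_of_mem t i.2⟩
  have := (hX.hasGaussianLaw (I.image t)).map_fun L
  convert! this using 2
  simp only [L, FunLike.coe_sum, Finset.sum_apply, FunLike.coe_smul,
    Pi.smul_apply, ContinuousLinearMap.proj_apply, Finset.restrict, smul_eq_mul]
  rw [Finset.sum_attach I fun i => c i * X (t i) _]

lemma integral_linearCombination (hX : IsGaussianProcess X P) (hc : ∀ t, ∫ ω, X t ω ∂P = 0)
    {ι : Type*} (I : Finset ι) (c t : ι → ℝ) : ∫ ω, ∑ i ∈ I, c i * X (t i) ω ∂P = 0 := by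
  rw [integral_finsetSum]
  · simp [integral_const_mul, hc]
  · exact fun i _ => (hX.hasGaussianLaw_eval (t i)).integrable.const_mul _

lemma covariance_sq_linearCombination (hX : IsGaussianProcess X P)
    (hc : ∀ t, ∫ ω, X t ω ∂P = 0) {ι κ : Type*} (I : Finset ι) (K : Finset κ)
    (c : ι → ℝ) (c' : κ → ℝ) (t : ι → ℝ) (u : κ → ℝ) :
    covariance (fun ω => (∑ i ∈ I, c i * X (t i) ω) ^ 2)
      (fun ω => (∑ k ∈ K, c' k * X (u k) ω) ^ 2) P =
    2 * (∫ ω, (∑ i ∈ I, c i * X (t i) ω) * (∑ k ∈ K, c' k * X (u k) ω) ∂P) ^ 2 := by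
  -- Sum and difference (`ε = ±1`) are again linear combinations of values of `X`, indexed by the
  -- disjoint union.
  have hs : ∀ ε : ℝ, HasGaussianLaw
      (fun ω => ∑ i ∈ I, c i * X (t i) ω + ε * ∑ k ∈ K, c' k * X (u k) ω) P := fun ε => by
    have := hasGaussianLaw_linearCombination hX (I.disjSum K) (Sum.elim c fun k => ε * c' k)
      (Sum.elim t u)
    simpa [Finset.sum_disjSum, Finset.mul_sum, mul_assoc] using this
  exact covariance_sq_sq_of_hasGaussianLaw (hasGaussianLaw_linearCombination hX _ _ _)
    (hasGaussianLaw_linearCombination hX _ _ _) (by simpa using hs 1)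
    (by simpa [sub_eq_add_neg] using hs (-1)) 
    (integral_linearCombination hX hc _ _ _) (integral_linearCombination hX hc _ _ _)

end QuadVar

namespace QuadVar

/-! ### Covariance of the quadratic variations -/

/-- Going through `Finsupp.linearCombination` avoids describing the support of `conv a a'`, which
cancellations may shrink. -/
lemma sum_conv (a a' : ℤ →₀ ℝ) (g : ℤ → ℝ) :
    ∑ m ∈ (conv a a').support, conv a a' m * g m =
      ∑ k ∈ a.support, ∑ l ∈ a'.support, a k * a' l * g (k - l) := by
  have : Finsupp.linearCombination ℝ g (conv a a') =
      ∑ m ∈ (conv a a').support, conv a a' m * g m := by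
    simp [Finsupp.linearCombination_apply, Finsupp.sum]
  rw [← this]
  simp [conv, map_sum, Finsupp.linearCombination_single, -Finsupp.single_mul]

/-- Write `xy = (x² + y² - (x - y)²) / 2`; the zero sums cancel the pure squares, leaving only
increments. -/
lemma sum_mul_sum_eq_of_sum_eq_zero {ι κ : Type*} (I : Finset ι) (K : Finset κ) (c x : ι → ℝ)
    (c' y : κ → ℝ) (hc : ∑ i ∈ I, c i = 0) (hc' : ∑ k ∈ K, c' k = 0) :
    (∑ i ∈ I, c i * x i) * (∑ k ∈ K, c' k * y k) =
      ∑ i ∈ I, ∑ k ∈ K, -(1 / 2) * (c i * c' k) * (x i - y k) ^ 2 := by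
  have e : ∀ i k, -(1 / 2) * (c i * c' k) * (x i - y k) ^ 2 = (c i * x i) * (c' k * y k)
      - (1 / 2 * c i * x i ^ 2) * c' k - c i * (1 / 2 * c' k * y k ^ 2) := fun i k => by ring
  simp only [e, Finset.sum_sub_distrib, ← Finset.sum_mul_sum, hc, hc', mul_zero, zero_mul, sub_zero]

variable {Ω : Type*} [MeasurableSpace Ω] {P : Measure Ω} {X : ℝ → Ω → ℝ}

lemma integral_sq_increment (hstat : HasStationaryIncrements X P) (t u : ℝ) :
    ∫ ω, (X t ω - X u ω) ^ 2 ∂P = 2 * semivariogram X P (t - u) := by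
  have h := hstat u {t - u}
  have h2 := (h.comp (u := fun f : ({t - u} : Finset ℝ) → ℝ => f ⟨t - u, by simp⟩ ^ 2)
    (by fun_prop)).integral_eq
  simp only [Function.comp_def, add_sub_cancel] at h2
  rw [h2, semivariogram]; ring

lemma semivariogram_neg (hstat : HasStationaryIncrements X P) (h : ℝ) :
    semivariogram X P (-h) = semivariogram X P h := by
  have h1 := integral_sq_increment hstat 0 h
  have h2 := integral_sq_increment hstat h 0
  have : ∀ ω, (X 0 ω - X h ω) ^ 2 = (X h ω - X 0 ω) ^ 2 := fun ω => by ring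
  simp only [this, h2, sub_zero, zero_sub] at h1
  linarith

lemma integral_diff_mul_diff (hX : IsGaussianProcess X P) (hstat : HasStationaryIncrements X P)
    {a a' : ℤ →₀ ℝ} (ha : ∑ j ∈ a.support, a j = 0) (ha' : ∑ j ∈ a'.support, a' j = 0)
    (δ : ℝ) (i i' : ℤ) :
    ∫ ω, diff δ a i (fun t => X t ω) * diff δ a' i' (fun t => X t ω) ∂P =
      -diff δ (conv a a') (i - i') (semivariogram X P) := by
  have int : ∀ t u c, Integrable (fun ω => c * (X t ω - X u ω) ^ 2) P := fun t u c =>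
    (hX.hasGaussianLaw_fun_sub.memLp_two.integrable_sq).const_mul c
  simp only [diff, sum_mul_sum_eq_of_sum_eq_zero _ _ _ _ _ _ ha ha']
  rw [sum_conv a a' fun j => semivariogram X P ((((i - i' : ℤ) : ℝ) + j) * δ),
    integral_finsetSum _ fun _ _ => integrable_finsetSum _ fun _ _ => int _ _ _,
    ← Finset.sum_neg_distrib]
  refine Finset.sum_congr rfl fun k _ => ?_
  rw [integral_finsetSum _ fun _ _ => int _ _ _, ← Finset.sum_neg_distrib]
  refine Finset.sum_congr rfl fun l _ => ?_
  rw [integral_const_mul, integral_sq_increment hstat]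
  have : (((i : ℝ) + k) * δ - (i' + l) * δ) = (((i - i' : ℤ) : ℝ) + ((k - l : ℤ) : ℝ)) * δ := by
    push_cast; ring
  rw [this]; ring

lemma covariance_quadVariation [IsProbabilityMeasure P] (hX : IsGaussianProcess X P)
    (hc : ∀ t, ∫ ω, X t ω ∂P = 0) (hstat : HasStationaryIncrements X P)
    {a a' : ℤ →₀ ℝ} (ha : ∑ j ∈ a.support, a j = 0) (ha' : ∑ j ∈ a'.support, a' j = 0)
    (α : ℝ) (n : ℕ) :
    covariance (quadVariation X α a n) (quadVariation X α a' n) P =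
      ∑ i ∈ Finset.Icc 1 (n + 1 - length a), ∑ i' ∈ Finset.Icc 1 (n + 1 - length a'),
        2 * diff ((n : ℝ) ^ (-α)) (conv a a') ((i : ℤ) - (i' : ℤ)) (semivariogram X P) ^ 2 := by
  have q2 : ∀ (b : ℤ →₀ ℝ) (δ : ℝ) (i : ℤ), MemLp (fun ω => diff δ b i (fun t => X t ω) ^ 2) 2 P := by
    intro b δ i
    exact memLp_sq_of_hasGaussianLaw (hasGaussianLaw_linearCombination hX b.support b
      fun j : ℤ => ((i : ℝ) + j) * δ)
  unfold quadVariation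
  rw [covariance_fun_sum_fun_sum' (fun i _ => q2 _ _ _) (fun i _ => q2 _ _ _)]
  refine Finset.sum_congr rfl fun i _ => Finset.sum_congr rfl fun i' _ => ?_
  have h := covariance_sq_linearCombination hX hc a.support a'.support a a'
    (fun j : ℤ => (((i : ℤ) : ℝ) + j) * (n : ℝ) ^ (-α))
    (fun j : ℤ => (((i' : ℤ) : ℝ) + j) * (n : ℝ) ^ (-α))
  have h' := integral_diff_mul_diff hX hstat ha ha' ((n : ℝ) ^ (-α)) i i'
  simp only [diff] at h' ⊢
  rw [h, h']; ring

/-! ### Moments and integral remainders -/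

lemma moment_conv (a a' : ℤ →₀ ℝ) (m : ℕ) :
    ∑ j ∈ (conv a a').support, conv a a' j * (j : ℝ) ^ m =
      ∑ p ∈ Finset.range (m + 1), (-1) ^ (m - p) * m.choose p *
        (∑ k ∈ a.support, a k * (k : ℝ) ^ p) * ∑ l ∈ a'.support, a' l * (l : ℝ) ^ (m - p) := by
  rw [sum_conv a a' fun j => (j : ℝ) ^ m]
  have e : ∀ k l : ℤ, ((k - l : ℤ) : ℝ) ^ m =
      ∑ p ∈ Finset.range (m + 1), (k : ℝ) ^ p * (-l : ℝ) ^ (m - p) * m.choose p := fun k l => by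
    push_cast; rw [sub_eq_add_neg, add_pow]
  simp only [e, Finset.mul_sum]
  rw [Finset.sum_congr rfl fun k _ => Finset.sum_comm, Finset.sum_comm]
  refine Finset.sum_congr rfl fun p _ => ?_
  simp only [Finset.sum_mul]
  rw [Finset.sum_comm]
  refine Finset.sum_congr rfl fun k _ => Finset.sum_congr rfl fun l _ => ?_
  rw [neg_pow]; ring

lemma moment_eq_zero_of_lt_order {a : ℤ →₀ ℝ} {k : ℕ} (hk : k < order a) :
    ∑ j ∈ a.support, a j * (j : ℝ) ^ k = 0 := by
  by_contra h
  exact Nat.notMem_of_lt_sInf hk h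

lemma moment_order_ne_zero {a : ℤ →₀ ℝ} (h : 0 < order a) :
    ∑ j ∈ a.support, a j * (j : ℝ) ^ order a ≠ 0 :=
  Nat.sInf_mem (Nat.nonempty_of_pos_sInf h)

/-- In every term of the binomial expansion, one of the exponents `p`, `m - p` is below the
corresponding order. -/
lemma moment_conv_eq_zero {a a' : ℤ →₀ ℝ} {m : ℕ} (hm : m < order a + order a') :
    ∑ j ∈ (conv a a').support, conv a a' j * (j : ℝ) ^ m = 0 := by
  rw [moment_conv]
  refine Finset.sum_eq_zero fun p hp => ?_
  rcases lt_or_ge p (order a) with h | h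
  · rw [moment_eq_zero_of_lt_order h]; ring
  · have := Finset.mem_range.1 hp
    rw [moment_eq_zero_of_lt_order (a := a') (k := m - p) (by omega)]; ring

lemma moment_conv_ne_zero {a a' : ℤ →₀ ℝ} (h : 0 < order a) (h' : 0 < order a') :
    ∑ j ∈ (conv a a').support, conv a a' j * (j : ℝ) ^ (order a + order a') ≠ 0 := by
  rw [moment_conv, Finset.sum_eq_single (order a)]
  · have := (Nat.choose_pos (Nat.le_add_right (order a) (order a'))).ne'
    rw [Nat.add_sub_cancel_left]
    have := moment_order_ne_zero h
    have := moment_order_ne_zero h'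
    positivity
  · intro p hp hne
    rcases lt_or_gt_of_ne hne with hlt | hgt
    · rw [moment_eq_zero_of_lt_order hlt]; ring
    · rw [moment_eq_zero_of_lt_order (a := a') (k := order a + order a' - p) (by omega)]; ring
  · intro h; simp at h

lemma integral_taylor_step {f f' : ℝ → ℝ} {S : Set ℝ} {x y δ : ℝ}
    (hS : ∀ η ∈ Set.Icc (0 : ℝ) 1, (x + y * η) * δ ∈ S)
    (hd : ∀ z ∈ S, HasDerivAt f (f' z) z) (hc : ContinuousOn f' S) (p : ℕ) :
    ∫ η in (0 : ℝ)..1, (1 - η) ^ p / (p.factorial : ℝ) * f ((x + y * η) * δ) =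
      f (x * δ) / ((p + 1).factorial : ℝ) + y * δ *
        ∫ η in (0 : ℝ)..1, (1 - η) ^ (p + 1) / ((p + 1).factorial : ℝ) * f' ((x + y * η) * δ) := by
  have hu : ∀ η ∈ Set.uIcc (0 : ℝ) 1,
      HasDerivAt (fun η : ℝ => (1 - η) ^ (p + 1) / ((p + 1).factorial : ℝ))
        (-((1 - η) ^ p / (p.factorial : ℝ))) η := fun η _ => by
    have := (((hasDerivAt_id η).const_sub 1).pow (p + 1)).div_const ((p + 1).factorial : ℝ)
    refine this.congr_deriv ?_
    simp only [id, Nat.factorial_succ]; push_cast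
    have : (p.factorial : ℝ) ≠ 0 := by positivity
    field_simp
  have hv : ∀ η ∈ Set.uIcc (0 : ℝ) 1,
      HasDerivAt (fun η : ℝ => f ((x + y * η) * δ)) (f' ((x + y * η) * δ) * (y * δ)) η := fun η hη => by
    rw [Set.uIcc_of_le zero_le_one] at hη
    have h1 : HasDerivAt (fun η : ℝ => (x + y * η) * δ) (y * δ) η := by
      simpa using (((hasDerivAt_id η).const_mul y).const_add x).mul_const δ
    exact (hd _ (hS η hη)).comp η h1
  have ci : ContinuousOn (fun η : ℝ => f' ((x + y * η) * δ)) (Set.uIcc 0 1) := by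
    rw [Set.uIcc_of_le zero_le_one]
    exact hc.comp (by fun_prop) hS
  have h := intervalIntegral.integral_mul_deriv_eq_deriv_mul hu hv
    (by apply Continuous.intervalIntegrable; fun_prop)
    ((ci.mul continuousOn_const).intervalIntegrable)
  simp only [sub_self, ne_eq, Nat.add_eq_zero_iff, one_ne_zero, and_false, not_false_eq_true,
    zero_pow, zero_div, zero_mul, sub_zero, one_pow, mul_zero, add_zero, neg_mul,
    intervalIntegral.integral_neg, mul_one] at h
  rw [← intervalIntegral.integral_const_mul]
  have e : ∀ η, y * δ * ((1 - η) ^ (p + 1) / ((p + 1).factorial : ℝ) * f' ((x + y * η) * δ)) =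
    (1 - η) ^ (p + 1) / ((p + 1).factorial : ℝ) * (f' ((x + y * η) * δ) * (y * δ)) := fun η => by ring
  simp only [e]
  rw [h]; ring

/-- One integration by parts in `η` (the fundamental theorem of calculus if `q = 0`). The boundary
term is `f(iδ) / q!`, the same for all `j`, so the vanishing `q`-th moment removes it. -/
lemma R_eq_mul_R_succ {f f' : ℝ → ℝ} {S : Set ℝ} {i : ℤ} {δ : ℝ} {q : ℕ} {b : ℤ →₀ ℝ}
    (hS : ∀ j ∈ b.support, ∀ η ∈ Set.Icc (0 : ℝ) 1, ((i : ℝ) + j * η) * δ ∈ S)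
    (hd : ∀ z ∈ S, HasDerivAt f (f' z) z) (hc : ContinuousOn f' S)
    (hb : ∑ j ∈ b.support, b j * (j : ℝ) ^ q = 0) :
    R i δ q f b = δ * R i δ (q + 1) f' b := by
  cases q with
  | zero =>
    have e : ∀ j ∈ b.support, b j * f (((i : ℝ) + j) * δ) = b j * (j : ℝ) ^ 0 * f (i * δ) + δ * 
        (b j * (j : ℝ) ^ (0 + 1) * ∫ η in (0 : ℝ)..1,
          (1 - η) ^ 0 / (Nat.factorial 0 : ℝ) * f' (((i : ℝ) + j * η) * δ)) := fun j hj => by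
      have hv : ∀ η ∈ Set.uIcc (0 : ℝ) 1,
          HasDerivAt (fun η : ℝ => f ((i + j * η) * δ)) (f' ((i + j * η) * δ) * (j * δ)) η :=
        fun η hη => by
        rw [Set.uIcc_of_le zero_le_one] at hη
        have h1 : HasDerivAt (fun η : ℝ => ((i : ℝ) + j * η) * δ) (j * δ) η := by
          simpa using (((hasDerivAt_id η).const_mul (j : ℝ)).const_add (i : ℝ)).mul_const δ
        exact (hd _ (hS j hj η hη)).comp η h1
      have ci : ContinuousOn (fun η : ℝ => f' ((i + j * η) * δ)) (Set.uIcc 0 1) := by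
        rw [Set.uIcc_of_le zero_le_one]
        exact hc.comp (by fun_prop) (hS j hj)
      have h := intervalIntegral.integral_eq_sub_of_hasDerivAt hv
        ((ci.mul continuousOn_const).intervalIntegrable)
      rw [intervalIntegral.integral_mul_const] at h
      simp only [mul_one, mul_zero, add_zero] at h
      have h2 : f (((i : ℝ) + j) * δ) = f (i * δ) +
          (∫ η in (0 : ℝ)..1, f' ((i + j * η) * δ)) * (j * δ) := by rw [h]; ring
      rw [h2]; simp; ring
    simp only [R, diff]
    rw [Finset.sum_congr rfl e, Finset.sum_add_distrib, ← Finset.sum_mul, hb, ← Finset.mul_sum]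
    ring
  | succ p =>
    have e : ∀ j ∈ b.support, b j * (j : ℝ) ^ (p + 1) *
        (∫ η in (0 : ℝ)..1, (1 - η) ^ p / (p.factorial : ℝ) * f (((i : ℝ) + j * η) * δ)) =
        b j * (j : ℝ) ^ (p + 1) * (f (i * δ) / ((p + 1).factorial : ℝ)) + δ *
        (b j * (j : ℝ) ^ (p + 1 + 1) * ∫ η in (0 : ℝ)..1,
          (1 - η) ^ (p + 1) / ((p + 1).factorial : ℝ) * f' (((i : ℝ) + j * η) * δ)) := fun j hj => by
      rw [integral_taylor_step (hS j hj) hd hc]; ring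
    simp only [R]
    rw [Finset.sum_congr rfl e, Finset.sum_add_distrib, ← Finset.sum_mul, hb, ← Finset.mul_sum]
    ring

end QuadVar

namespace QuadVar

/-! ### Algebra and bounds for the integral remainders -/

lemma R_eq_pow_mul_R_add {F : ℕ → ℝ → ℝ} {S : Set ℝ} {i : ℤ} {δ : ℝ} {q : ℕ} {b : ℤ →₀ ℝ} (d : ℕ)
    (hS : ∀ j ∈ b.support, ∀ η ∈ Set.Icc (0 : ℝ) 1, ((i : ℝ) + j * η) * δ ∈ S)
    (hd : ∀ m < d, ∀ z ∈ S, HasDerivAt (F m) (F (m + 1) z) z)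
    (hc : ∀ m < d, ContinuousOn (F (m + 1)) S)
    (hb : ∀ m < d, ∑ j ∈ b.support, b j * (j : ℝ) ^ (q + m) = 0) :
    R i δ q (F 0) b = δ ^ d * R i δ (q + d) (F d) b := by
  induction d with
  | zero => simp
  | succ d ih =>
    rw [ih (fun m hm => hd m (by omega)) (fun m hm => hc m (by omega)) (fun m hm => hb m (by omega)),
      R_eq_mul_R_succ hS (hd d (by omega)) (hc d (by omega)) (hb d (by omega)), pow_succ, mul_assoc,
      add_assoc]

lemma R_const_mul (i : ℤ) (δ : ℝ) (q : ℕ) (f : ℝ → ℝ) (b : ℤ →₀ ℝ) (c : ℝ) :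
    R i δ q (fun x => c * f x) b = c * R i δ q f b := by
  cases q with
  | zero => simp only [R, diff, mul_neg, Finset.mul_sum, mul_left_comm]
  | succ p =>
    simp only [R, mul_left_comm _ c, intervalIntegral.integral_const_mul, ← Finset.mul_sum, mul_neg]

lemma R_add {f g : ℝ → ℝ} (hf : Continuous f) (hg : Continuous g) (i : ℤ) (δ : ℝ) (q : ℕ)
    (b : ℤ →₀ ℝ) : R i δ q (fun x => f x + g x) b = R i δ q f b + R i δ q g b := by
  cases q with
  | zero => simp only [R, diff, mul_add, Finset.sum_add_distrib]; ring
  | succ p =>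
    have e : ∀ j : ℤ, ∫ η in (0 : ℝ)..1, (1 - η) ^ p / (p.factorial : ℝ) *
          (f (((i : ℝ) + j * η) * δ) + g (((i : ℝ) + j * η) * δ)) =
        (∫ η in (0 : ℝ)..1, (1 - η) ^ p / (p.factorial : ℝ) * f (((i : ℝ) + j * η) * δ)) +
        ∫ η in (0 : ℝ)..1, (1 - η) ^ p / (p.factorial : ℝ) * g (((i : ℝ) + j * η) * δ) := fun j => by
      rw [← intervalIntegral.integral_add]
      · simp only [mul_add]
      · apply Continuous.intervalIntegrable; fun_prop
      · apply Continuous.intervalIntegrable; fun_prop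
    simp only [R, e]
    simp only [mul_add, Finset.sum_add_distrib, neg_add]

lemma R_const {b : ℤ →₀ ℝ} {q : ℕ} (hb : ∑ j ∈ b.support, b j * (j : ℝ) ^ q = 0) (i : ℤ) (δ c : ℝ) :
    R i δ q (fun _ => c) b = 0 := by
  -- The zero derivative is written `0 * 0` so that `R_const_mul` can extract a zero factor.
  rw [R_eq_mul_R_succ (S := Set.univ) (f' := fun _ => 0 * 0) (by simp)
    (fun z _ => by simpa using hasDerivAt_const z c) continuousOn_const hb, R_const_mul]
  simp

lemma R_abs_rpow (i : ℤ) {δ : ℝ} (hδ : 0 < δ) (q : ℕ) (s : ℝ) (b : ℤ →₀ ℝ) :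
    R i δ q (fun h => |h| ^ s) b = δ ^ s * R i 1 q (fun h => |h| ^ s) b := by
  have e : ∀ x : ℝ, |x * δ| ^ s = δ ^ s * |x * 1| ^ s := fun x => by
    rw [abs_mul, abs_of_pos hδ, Real.mul_rpow (abs_nonneg _) hδ.le, mul_one, mul_comm]
  rw [← R_const_mul]
  cases q <;> simp only [R, diff, e]

lemma abs_R_le {i : ℤ} {δ : ℝ} {q : ℕ} {f : ℝ → ℝ} {b : ℤ →₀ ℝ} {B : ℝ}
    (hf : ∀ j ∈ b.support, ∀ η ∈ Set.Icc (0 : ℝ) 1, |f (((i : ℝ) + j * η) * δ)| ≤ B) :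
    |R i δ q f b| ≤ B * ∑ j ∈ b.support, |b j| * |(j : ℝ)| ^ q := by
  cases q with
  | zero =>
    simp only [R, diff, abs_neg, Finset.mul_sum]
    refine (Finset.abs_sum_le_sum_abs _ _).trans (Finset.sum_le_sum fun j hj => ?_)
    have := hf j hj 1 (by simp)
    rw [mul_one] at this
    rw [abs_mul, pow_zero, mul_one, mul_comm B]
    gcongr
  | succ p =>
    simp only [R, abs_neg, Finset.mul_sum]
    refine (Finset.abs_sum_le_sum_abs _ _).trans (Finset.sum_le_sum fun j hj => ?_)
    rw [abs_mul, abs_mul, abs_pow, mul_comm B]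
    gcongr
    have := intervalIntegral.norm_integral_le_of_norm_le_const (a := 0) (b := 1) (C := B)
      (f := fun η : ℝ => (1 - η) ^ p / (p.factorial : ℝ) * f (((i : ℝ) + j * η) * δ)) ?_
    · simpa using this
    intro η hη
    rw [Set.uIoc_of_le zero_le_one] at hη
    have h1 := hf j hj η ⟨hη.1.le, hη.2⟩
    have h2 : |(1 - η) ^ p / (p.factorial : ℝ)| ≤ 1 := by
      rw [abs_div, abs_pow, Nat.abs_cast]
      refine div_le_one_of_le₀ ?_ (by positivity)
      have : |1 - η| ≤ 1 := abs_le.2 ⟨by linarith [hη.2], by linarith [hη.1]⟩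
      exact (pow_le_one₀ (abs_nonneg _) this).trans (by exact_mod_cast Nat.factorial_pos p)
    rw [Real.norm_eq_abs, abs_mul]
    calc _ ≤ 1 * B := mul_le_mul h2 h1 (abs_nonneg _) zero_le_one
      _ = B := one_mul B

/-- The segment from `k` to `k + j` stays away from zero when `|j| ≤ J < |k|`. -/
lemma div_le_abs_add_mul {k j : ℤ} {J : ℕ} (hk : (J : ℤ) < |k|) (hj : |j| ≤ J) {η : ℝ}
    (hη : η ∈ Set.Icc (0 : ℝ) 1) : |(k : ℝ)| / (J + 1) ≤ |(k : ℝ) + j * η| := by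
  have hk' : (J : ℝ) + 1 ≤ |(k : ℝ)| := by exact_mod_cast hk
  have hj' : |(j : ℝ)| ≤ J := by exact_mod_cast hj
  have h1 : |(j : ℝ) * η| ≤ J := by
    rw [abs_mul, abs_of_nonneg hη.1]
    calc _ ≤ (J : ℝ) * 1 := mul_le_mul hj' hη.2 hη.1 (by positivity)
      _ = J := mul_one _
  have h2 := abs_sub_abs_le_abs_sub (k : ℝ) (-(j * η))
  rw [abs_neg, sub_neg_eq_add] at h2
  have hJ : (0 : ℝ) ≤ J := by positivity
  have h3 : |(k : ℝ)| / (J + 1) ≤ |(k : ℝ)| - J := by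
    rw [div_le_iff₀ (by positivity)]
    nlinarith
  linarith

lemma abs_R_le_rpow {k : ℤ} {δ : ℝ} (hδ : 0 < δ) {q : ℕ} {f : ℝ → ℝ} {b : ℤ →₀ ℝ} {J : ℕ}
    (hJ : ∀ j ∈ b.support, |j| ≤ J) (hk : (J : ℤ) < |k|) {K β : ℝ} (hK : 0 ≤ K) (hβ : β ≤ 0)
    (hf : ∀ j ∈ b.support, ∀ η ∈ Set.Icc (0 : ℝ) 1,
      |f (((k : ℝ) + j * η) * δ)| ≤ K * |((k : ℝ) + j * η) * δ| ^ β) :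
    |R k δ q f b| ≤ K * ((J : ℝ) + 1) ^ (-β) * (∑ j ∈ b.support, |b j| * |(j : ℝ)| ^ q) *
      (δ ^ β * |(k : ℝ)| ^ β) := by
  have hJ0 : (0 : ℝ) < J + 1 := by positivity
  have hk0 : 0 < |(k : ℝ)| := by
    have : (0 : ℤ) < |k| := by omega
    exact_mod_cast this
  refine (abs_R_le (B := K * ((J : ℝ) + 1) ^ (-β) * (δ ^ β * |(k : ℝ)| ^ β)) fun j hj η hη => ?_).trans
    (le_of_eq (by ring))
  refine (hf j hj η hη).trans ?_
  rw [mul_assoc]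
  refine mul_le_mul_of_nonneg_left ?_ hK
  have h := div_le_abs_add_mul hk (hJ j hj) hη
  rw [abs_mul, abs_of_pos hδ, Real.mul_rpow (abs_nonneg _) hδ.le]
  calc _ ≤ (|(k : ℝ)| / (J + 1)) ^ β * δ ^ β := by
        exact mul_le_mul_of_nonneg_right (Real.rpow_le_rpow_of_nonpos (by positivity) h hβ)
          (by positivity)
    _ = _ := by
        rw [Real.div_rpow hk0.le hJ0.le, Real.rpow_neg hJ0.le]; field_simp

/-! ### Derivatives of `|x| ^ p` -/

/-- The `m`-th derivative of `|x| ^ p`. -/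
noncomputable def absRpowDeriv (p : ℝ) (m : ℕ) (x : ℝ) : ℝ :=
  (∏ i ∈ Finset.range m, (p - i)) * (|x| ^ (p - 2 * m) * x ^ m)

lemma absRpowDeriv_zero (p : ℝ) : absRpowDeriv p 0 = fun x => |x| ^ p := by
  ext x; simp [absRpowDeriv]

lemma abs_absRpowDeriv (p : ℝ) (m : ℕ) {x : ℝ} (hx : x ≠ 0) :
    |absRpowDeriv p m x| = |∏ i ∈ Finset.range m, (p - i)| * |x| ^ (p - m) := by
  have : 0 < |x| := abs_pos.2 hx
  rw [absRpowDeriv, abs_mul, abs_mul, abs_pow, abs_of_nonneg (Real.rpow_nonneg (abs_nonneg x) _),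
    ← Real.rpow_natCast, ← Real.rpow_add this]
  ring_nf

lemma absRpowDeriv_at_zero {p : ℝ} {m : ℕ} (hp : m < p) : absRpowDeriv p m 0 = 0 := by
  rcases Nat.eq_zero_or_pos m with rfl | hm
  · have : p ≠ 0 := by rintro rfl; simp at hp
    simp [absRpowDeriv, Real.zero_rpow this]
  · simp [absRpowDeriv, zero_pow hm.ne']

lemma abs_absRpowDeriv_le {p : ℝ} {m : ℕ} (hp : m < p) (x : ℝ) :
    |absRpowDeriv p m x| ≤ |∏ i ∈ Finset.range m, (p - i)| * |x| ^ (p - m) := by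
  rcases eq_or_ne x 0 with rfl | hx
  · rw [absRpowDeriv_at_zero hp, abs_zero]; positivity
  · exact (abs_absRpowDeriv p m hx).le

/-- At the origin the function is `O(|x|^(p-m-1) x) = o(x)`; elsewhere this is the product rule. -/
lemma hasDerivAt_absRpowDeriv {p : ℝ} {m : ℕ} {x : ℝ} (h : x ≠ 0 ∨ (m : ℝ) + 1 < p) :
    HasDerivAt (absRpowDeriv p m) (absRpowDeriv p (m + 1) x) x := by
  rcases eq_or_ne x 0 with rfl | hx
  · have hp : (m : ℝ) + 1 < p := by simpa using h
    have h0 : absRpowDeriv p (m + 1) 0 = 0 := by simp [absRpowDeriv]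
    rw [h0, hasDerivAt_iff_isLittleO_nhds_zero]
    simp only [zero_add, absRpowDeriv_at_zero (show (m : ℝ) < p by linarith), sub_zero, smul_zero]
    have h1 : absRpowDeriv p m =O[𝓝 0] fun x : ℝ => |x| ^ (p - m - 1) * x := by
      refine IsBigO.of_bound |∏ i ∈ Finset.range m, (p - i)| (Eventually.of_forall fun x => ?_)
      rw [norm_mul, Real.norm_eq_abs, Real.norm_eq_abs, Real.norm_eq_abs,
        abs_of_nonneg (Real.rpow_nonneg (abs_nonneg x) _)]
      refine (abs_absRpowDeriv_le (by linarith) x).trans (le_of_eq ?_)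
      congr 1
      rcases eq_or_ne x 0 with rfl | hx
      · rw [abs_zero, mul_zero, Real.zero_rpow (by linarith)]
      · rw [Real.rpow_sub_one (abs_pos.2 hx).ne', div_mul_cancel₀ _ (abs_pos.2 hx).ne']
    refine h1.trans_isLittleO ?_
    have h2 : (fun x : ℝ => |x| ^ (p - m - 1)) =o[𝓝 0] fun _ : ℝ => (1 : ℝ) := by
      rw [isLittleO_one_iff]
      have : ContinuousAt (fun x : ℝ => |x| ^ (p - m - 1)) 0 :=
        (continuous_abs.rpow_const fun x => Or.inr (by linarith)).continuousAt
      have h3 := this.tendsto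
      rwa [abs_zero, Real.zero_rpow (by linarith)] at h3
    simpa using h2.mul_isBigO (isBigO_refl (fun x : ℝ => x) (𝓝 0))
  · have hx' := abs_pos.2 hx
    have h1 : HasDerivAt (fun x : ℝ => |x| ^ (p - 2 * m))
        ((p - 2 * m) * (|x| ^ (p - 2 * (m + 1 : ℕ)) * x)) x := by
      have := (hasDerivAt_abs hx).rpow_const (p := p - 2 * m) (Or.inl hx'.ne')
      refine this.congr_deriv ?_
      have e : |x| ^ (p - 2 * m - 1) = |x| ^ (p - 2 * (m + 1 : ℕ)) * |x| := by
        rw [← Real.rpow_add_one hx'.ne']; push_cast; ring_nf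
      rw [e]
      linear_combination (p - 2 * m) * |x| ^ (p - 2 * (m + 1 : ℕ)) * sign_mul_abs x
    have h2 := ((h1.mul (hasDerivAt_pow m x)).const_mul (∏ i ∈ Finset.range m, (p - i)))
    refine h2.congr_deriv ?_
    have e : |x| ^ (p - 2 * m) = |x| ^ (p - 2 * (m + 1 : ℕ)) * x ^ 2 := by
      rw [← sq_abs x, ← Real.rpow_natCast, ← Real.rpow_add hx']; push_cast; ring_nf
    rw [absRpowDeriv, Finset.prod_range_succ, e]
    rcases m with _ | m
    · simp
    · simp only [Nat.add_sub_cancel]; push_cast; ring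

lemma continuousAt_absRpowDeriv {p : ℝ} {m : ℕ} {x : ℝ} (h : x ≠ 0 ∨ (m : ℝ) < p) :
    ContinuousAt (absRpowDeriv p m) x := by
  rcases eq_or_ne x 0 with rfl | hx
  · have hp : (m : ℝ) < p := by simpa using h
    rw [ContinuousAt, absRpowDeriv_at_zero hp]
    refine squeeze_zero_norm (a := fun x : ℝ => |∏ i ∈ Finset.range m, (p - i)| * |x| ^ (p - m))
      (fun x => abs_absRpowDeriv_le hp x) ?_
    have : ContinuousAt (fun x : ℝ => |∏ i ∈ Finset.range m, (p - i)| * |x| ^ (p - m)) 0 :=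
      ((continuous_abs.rpow_const fun x => Or.inr (by linarith)).const_mul _).continuousAt
    have h3 := this.tendsto
    rwa [abs_zero, Real.zero_rpow (by linarith), mul_zero] at h3
  · exact (hasDerivAt_absRpowDeriv (Or.inl hx)).continuousAt

lemma absRpowDeriv_two_mul {s : ℝ} (hs : 0 < s) (D : ℕ) (x : ℝ) :
    absRpowDeriv (2 * D + s) (2 * D) x =
      (∏ i ∈ Finset.range (2 * D), (2 * D + s - i)) * |x| ^ s := by
  rw [absRpowDeriv]
  congr 1
  rcases eq_or_ne x 0 with rfl | hx
  · rcases Nat.eq_zero_or_pos D with rfl | hD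
    · simp
    · rw [zero_pow (by omega), abs_zero, Real.zero_rpow hs.ne', mul_zero]
  · rw [pow_mul, ← sq_abs, ← pow_mul, ← Real.rpow_natCast, ← Real.rpow_add (abs_pos.2 hx)]
    push_cast; ring_nf

/-! ### The limiting remainders -/

lemma diff_abs_rpow {s : ℝ} (hs : 0 < s) {D : ℕ} {b : ℤ →₀ ℝ}
    (hb : ∀ m < 2 * D, ∑ j ∈ b.support, b j * (j : ℝ) ^ m = 0) (k : ℤ) :
    -diff 1 b k (fun x => |x| ^ (2 * D + s)) =
      (∏ i ∈ Finset.range (2 * D), (2 * D + s - i)) * R k 1 (2 * D) (fun h => |h| ^ s) b := by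
  have h := R_eq_pow_mul_R_add (F := absRpowDeriv (2 * D + s)) (S := Set.univ) (i := k) (δ := 1)
    (q := 0) (b := b) (2 * D) (by simp)
    (fun m hm z _ => hasDerivAt_absRpowDeriv (Or.inr (by
      have : (m : ℝ) + 1 ≤ 2 * D := by exact_mod_cast hm
      linarith)))
    (fun m hm => continuousOn_of_forall_continuousAt fun z _ =>
      continuousAt_absRpowDeriv (Or.inr (by
        have : ((m + 1 : ℕ) : ℝ) ≤ 2 * D := by exact_mod_cast hm
        linarith)))
    (fun m hm => by simpa using hb m hm)
  rw [absRpowDeriv_zero, zero_add, funext (absRpowDeriv_two_mul hs D), R_const_mul, one_pow,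
    one_mul] at h
  exact h

/-- For `|k| > J` no segment from `k` to `k + j` meets the singularity at 0, so `d` further Taylor
steps apply, and the `d`-th derivative of `|x|^s` has size `|x|^(s-d)`. -/
lemma abs_R_abs_rpow_le {s : ℝ} {q d : ℕ} (hsd : s ≤ d) {b : ℤ →₀ ℝ} {J : ℕ}
    (hJ : ∀ j ∈ b.support, |j| ≤ J)
    (hb : ∀ m < q + d, ∑ j ∈ b.support, b j * (j : ℝ) ^ m = 0) :
    ∃ K, ∀ k : ℤ, (J : ℤ) < |k| → |R k 1 q (fun h => |h| ^ s) b| ≤ K * |(k : ℝ)| ^ (s - d) := by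
  refine ⟨|∏ i ∈ Finset.range d, (s - i)| * ((J : ℝ) + 1) ^ (-(s - d)) *
    ∑ j ∈ b.support, |b j| * |(j : ℝ)| ^ (q + d), fun k hk => ?_⟩
  have hne : ∀ j ∈ b.support, ∀ η ∈ Set.Icc (0 : ℝ) 1, ((k : ℝ) + j * η) * 1 ≠ 0 := by
    intro j hj η hη
    have h := div_le_abs_add_mul hk (hJ j hj) hη
    have hk0 : 0 < |(k : ℝ)| := by
      have : (0 : ℤ) < |k| := by omega
      exact_mod_cast this
    rw [mul_one]
    exact abs_pos.1 (lt_of_lt_of_le (by positivity) h)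
  have h := R_eq_pow_mul_R_add (F := absRpowDeriv s) (S := {x | x ≠ 0}) (i := k) (δ := 1)
    (q := q) (b := b) d hne (fun m hm z hz => hasDerivAt_absRpowDeriv (Or.inl hz))
    (fun m hm => continuousOn_of_forall_continuousAt fun z hz =>
      continuousAt_absRpowDeriv (Or.inl hz))
    (fun m hm => hb _ (by omega))
  rw [← absRpowDeriv_zero, h, one_pow, one_mul]
  have := abs_R_le_rpow one_pos hJ hk (abs_nonneg (∏ i ∈ Finset.range d, (s - i)))
    (sub_nonpos.2 hsd) (q := q + d) (f := absRpowDeriv s d)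
    (fun j hj η hη => (abs_absRpowDeriv s d (hne j hj η hη)).le)
  rwa [Real.one_rpow, one_mul] at this

lemma summable_int_rpow_sq {β : ℝ} (hβ : β < -1 / 2) (K : ℝ) :
    Summable fun k : ℤ => (K * |(k : ℝ)| ^ β) ^ 2 := by
  have := (Real.summable_abs_int_rpow (b := -(2 * β)) (by linarith)).mul_left (K ^ 2)
  refine this.congr fun k => ?_
  rw [mul_pow, ← Real.rpow_natCast (|(k : ℝ)| ^ β), ← Real.rpow_mul (abs_nonneg _)]
  push_cast; ring_nf

lemma finite_abs_le (J : ℕ) : {k : ℤ | |k| ≤ J}.Finite :=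
  (Set.finite_Icc (-(J : ℤ)) J).subset fun _ hk => abs_le.1 hk

end QuadVar

namespace QuadVar

lemma exists_abs_le_of_mem_support (b : ℤ →₀ ℝ) : ∃ J : ℕ, ∀ j ∈ b.support, |j| ≤ J :=
  ⟨b.support.sup Int.natAbs, fun j hj => by
    have := Finset.le_sup (f := Int.natAbs) hj
    rw [Int.abs_eq_natAbs]; exact_mod_cast this⟩

/-! ### Non-degeneracy of the limit -/

lemma sum_mul_add_pow_eq_zero {b : ℤ →₀ ℝ} {p : ℕ}
    (hb : ∀ m ≤ p, ∑ j ∈ b.support, b j * (j : ℝ) ^ m = 0) (x : ℝ) :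
    ∑ j ∈ b.support, b j * (x + j) ^ p = 0 := by
  have e : ∀ j : ℤ, b j * (x + j) ^ p =
      ∑ m ∈ Finset.range (p + 1), x ^ m * p.choose m * (b j * (j : ℝ) ^ (p - m)) := fun j => by
    rw [add_pow, Finset.mul_sum]
    exact Finset.sum_congr rfl fun m _ => by ring
  simp only [e]
  rw [Finset.sum_comm]
  refine Finset.sum_eq_zero fun m _ => ?_
  rw [← Finset.mul_sum, hb _ (Nat.sub_le _ _), mul_zero]

/-- The differences of `x^p` vanish, so only points where `|x|^p ≠ x^p` matter. With `k = -1 - j₀`,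
`j₀` the least index of the support, the only such point is `k + j₀ = -1`. -/
lemma exists_sum_abs_pow_ne_zero {b : ℤ →₀ ℝ} {p : ℕ} (hp : Odd p)
    (hb : ∀ m ≤ p, ∑ j ∈ b.support, b j * (j : ℝ) ^ m = 0) (hb0 : b.support.Nonempty) :
    ∃ k : ℤ, ∑ j ∈ b.support, b j * |(k : ℝ) + j| ^ p ≠ 0 := by
  set j₀ := b.support.min' hb0 with hj₀
  have hmem : j₀ ∈ b.support := Finset.min'_mem _ _
  refine ⟨-1 - j₀, fun h => ?_⟩
  have h2 := sum_mul_add_pow_eq_zero hb ((-1 - j₀ : ℤ) : ℝ)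
  have h3 : ∑ j ∈ b.support, (b j * |((-1 - j₀ : ℤ) : ℝ) + j| ^ p -
      b j * (((-1 - j₀ : ℤ) : ℝ) + j) ^ p) = 2 * b j₀ := by
    rw [Finset.sum_eq_single_of_mem j₀ hmem]
    · push_cast
      rw [sub_add_cancel, abs_neg, abs_one, one_pow, hp.neg_one_pow]; ring
    · intro j hj hne
      have h4 : j₀ ≤ j := Finset.min'_le _ _ hj
      have h5 : (0 : ℝ) ≤ ((-1 - j₀ : ℤ) : ℝ) + j := by
        have : 0 ≤ -1 - j₀ + j := by omega
        exact_mod_cast this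
      rw [abs_of_nonneg h5, sub_self]
  rw [Finset.sum_sub_distrib, h, h2, sub_zero] at h3
  have := Finsupp.mem_support_iff.1 hmem
  apply this; linarith

/-- Expansion at infinity: `φ 0` is analytic at 0 and vanishes at `1/n` for large `n`, hence near 0.
Since `(φ m)' = (p - m) φ (m+1)` with `p ≠ m`, all `φ m` vanish near 0, and `φ m 0` is the `m`-th
moment. -/
lemma moments_eq_zero_of_sum_rpow_eq_zero {b : ℤ →₀ ℝ} {p : ℝ} (hp : ∀ m : ℕ, p ≠ m)
    (h : ∀ k : ℤ, ∑ j ∈ b.support, b j * |(k : ℝ) + j| ^ p = 0) (m : ℕ) :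
    ∑ j ∈ b.support, b j * (j : ℝ) ^ m = 0 := by
  let φ : ℕ → ℝ → ℝ := fun m t => ∑ j ∈ b.support, b j * (j : ℝ) ^ m * (1 + j * t) ^ (p - m)
  suffices hφ : ∀ m, φ m =ᶠ[𝓝 0] fun _ => 0 by
    simpa [φ] using (hφ m).self_of_nhds
  have hpos : ∀ᶠ t in 𝓝 (0 : ℝ), ∀ j ∈ b.support, 0 < 1 + (j : ℝ) * t := by
    refine (Filter.eventually_all_finset _).2 fun j _ => ?_
    have : ContinuousAt (fun t : ℝ => 1 + (j : ℝ) * t) 0 := by fun_prop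
    exact this.eventually_const_lt (by simp)
  intro m
  induction m with
  | zero =>
    have han : AnalyticAt ℝ (φ 0) 0 := by
      refine Finset.analyticAt_fun_sum _ fun j _ => analyticAt_const.mul ?_
      rw [← analyticWithinAt_univ, ← contDiffWithinAt_omega_iff_analyticWithinAt]
      exact ContDiffWithinAt.rpow_const_of_ne (by fun_prop) (by simp)
    refine han.frequently_zero_iff_eventually_zero.1 ?_
    have ht : Tendsto (fun n : ℕ => ((n : ℝ))⁻¹) atTop (𝓝[≠] 0) :=
      (tendsto_inv_atTop_nhdsGT_zero.comp tendsto_natCast_atTop_atTop).mono_right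
        (nhdsGT_le_nhdsNE 0)
    refine ht.frequently (Eventually.frequently ?_)
    obtain ⟨J, hJ⟩ := exists_abs_le_of_mem_support b
    filter_upwards [eventually_gt_atTop J] with n hn
    have hn0 : (0 : ℝ) < n := by exact_mod_cast (Nat.zero_le J).trans_lt hn
    have e : ∀ j ∈ b.support, b j * (j : ℝ) ^ 0 * (1 + j * (n : ℝ)⁻¹) ^ (p - (0 : ℕ)) =
        (n : ℝ)⁻¹ ^ p * (b j * |((n : ℤ) : ℝ) + j| ^ p) := fun j hj => by
      have h1 : (0 : ℝ) < n + j := by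
        have h2 := (abs_le.1 (hJ j hj)).1
        have : (0 : ℤ) < n + j := by omega
        exact_mod_cast this
      have h3 : 1 + (j : ℝ) * (n : ℝ)⁻¹ = (n : ℝ)⁻¹ * (n + j) := by field_simp
      rw [h3, Int.cast_natCast, abs_of_pos h1, Nat.cast_zero, sub_zero,
        Real.mul_rpow (by positivity) h1.le]
      ring
    simp only [φ]
    rw [Finset.sum_congr rfl e, ← Finset.mul_sum, h, mul_zero]
  | succ m ih =>
    have h1 : deriv (φ m) =ᶠ[𝓝 0] fun _ => 0 := by
      refine ih.deriv.trans (Eventually.of_forall fun t => by simp)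
    have hm : p - m ≠ 0 := sub_ne_zero.2 (hp m)
    filter_upwards [h1, hpos] with t ht htp
    have hd : HasDerivAt (φ m) ((p - m) * φ (m + 1) t) t := by
      simp only [φ, Finset.mul_sum]
      refine HasDerivAt.fun_sum fun j hj => ?_
      have h2 : HasDerivAt (fun t : ℝ => 1 + (j : ℝ) * t) j t := by
        simpa using ((hasDerivAt_id t).const_mul (j : ℝ)).const_add 1
      have := (h2.rpow_const (p := p - m) (Or.inl (htp j hj).ne')).const_mul (b j * (j : ℝ) ^ m)
      refine this.congr_deriv ?_
      push_cast
      rw [← sub_sub]; ring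
    rw [hd.deriv] at ht
    exact (mul_eq_zero.1 ht).resolve_left hm

lemma exists_R_abs_rpow_ne_zero {s : ℝ} (hs : 0 < s) (hs2 : s < 2) {D q : ℕ} {b : ℤ →₀ ℝ}
    (hb : ∀ m < 2 * D + 2, ∑ j ∈ b.support, b j * (j : ℝ) ^ m = 0)
    (hq : ∑ j ∈ b.support, b j * (j : ℝ) ^ q ≠ 0) :
    ∃ k : ℤ, R k 1 (2 * D) (fun h => |h| ^ s) b ≠ 0 := by
  by_contra! hR
  have h : ∀ k : ℤ, ∑ j ∈ b.support, b j * |(k : ℝ) + j| ^ (2 * D + s) = 0 := fun k => by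
    have := diff_abs_rpow hs (D := D) (fun m hm => hb m (by omega)) k
    rw [hR k, mul_zero, neg_eq_zero] at this
    simpa [diff] using this
  -- As `2D < 2D + s < 2D + 2`, the exponent is an integer only for `s = 1`.
  rcases eq_or_ne s 1 with rfl | hs1
  · have hb0 : b.support.Nonempty := by
      by_contra h0
      rw [Finset.not_nonempty_iff_eq_empty] at h0
      simp [h0] at hq
    obtain ⟨k, hk⟩ := exists_sum_abs_pow_ne_zero (p := 2 * D + 1) ⟨D, rfl⟩
      (fun m hm => hb m (by omega)) hb0
    refine hk ?_
    rw [← h k]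
    refine Finset.sum_congr rfl fun j _ => ?_
    rw [← Real.rpow_natCast]; push_cast; rfl
  · refine hq (moments_eq_zero_of_sum_rpow_eq_zero (fun m hm => ?_) h q)
    have h1 : ((2 * D : ℕ) : ℝ) < m := by push_cast; linarith
    have h2 : (m : ℝ) < ((2 * D + 2 : ℕ) : ℝ) := by push_cast; linarith
    have h3 : m = 2 * D + 1 := by
      have := Nat.cast_lt.1 h1; have := Nat.cast_lt.1 h2; omega
    subst h3
    push_cast at hm
    exact hs1 (by linarith)

end QuadVar

namespace QuadVar

/-! ### The remainder of the semi-variogram -/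

lemma contDiffAt_iteratedDeriv {f : ℝ → ℝ} {x : ℝ}
    (hf : ContDiffAt ℝ ((⊤ : ℕ∞) : WithTop ℕ∞) f x) (m : ℕ) :
    ContDiffAt ℝ ((⊤ : ℕ∞) : WithTop ℕ∞) (iteratedDeriv m f) x := by
  induction m with
  | zero => simpa using hf
  | succ m ih =>
    have h := (ih.fderiv_right (m := ((⊤ : ℕ∞) : WithTop ℕ∞)) (by simp)).clm_apply
      (contDiffAt_const (c := (1 : ℝ)))
    rw [iteratedDeriv_succ]
    exact h

variable {V : ℝ → ℝ} {α C s : ℝ} {D : ℕ}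

lemma contDiffAt_of_H0 (h0 : H0 V) (heven : ∀ x, V (-x) = V x) {x : ℝ} (hx : x ≠ 0) :
    ContDiffAt ℝ ((⊤ : ℕ∞) : WithTop ℕ∞) V x := by
  rcases lt_or_gt_of_ne hx with h | h
  · have h1 : ContDiffAt ℝ ((⊤ : ℕ∞) : WithTop ℕ∞) V (-x) :=
      h0.contDiffAt (Ioi_mem_nhds (neg_pos.2 h))
    have h2 := h1.comp x contDiff_neg.contDiffAt
    have : V ∘ Neg.neg = V := funext heven
    rwa [this] at h2
  · exact h0.contDiffAt (Ioi_mem_nhds h)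

lemma contDiffAt_remainder (h0 : H0 V) (heven : ∀ x, V (-x) = V x) {x : ℝ} (hx : x ≠ 0) :
    ContDiffAt ℝ ((⊤ : ℕ∞) : WithTop ℕ∞) (remainder V D C s) x :=
  ((contDiffAt_iteratedDeriv (contDiffAt_of_H0 h0 heven hx) _).sub contDiffAt_const).sub
    (contDiffAt_const.mul ((contDiffAt_abs hx).rpow_const_of_ne (abs_pos.2 hx).ne'))

lemma remainder_zero (h1 : H1 V α D C s) : remainder V D C s 0 = 0 := by
  simp [remainder, Real.zero_rpow h1.s_pos.ne']

lemma continuous_abs_rpow (hs : 0 < s) : Continuous fun h : ℝ => |h| ^ s :=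
  continuous_abs.rpow_const fun _ => Or.inr hs.le

lemma continuous_remainder (h0 : H0 V) (heven : ∀ x, V (-x) = V x) (h1 : H1 V α D C s) :
    Continuous (remainder V D C s) := by
  rw [continuous_iff_continuousAt]
  intro x
  rcases eq_or_ne x 0 with rfl | hx
  · have h2 := ((continuous_abs_rpow h1.s_pos).tendsto 0)
    rw [abs_zero, Real.zero_rpow h1.s_pos.ne'] at h2
    rw [ContinuousAt, remainder_zero h1]
    exact h1.isLittleO.isBigO.trans_tendsto h2
  · exact (contDiffAt_remainder h0 heven hx).continuousAt

lemma iteratedDeriv_eq_add_remainder (V : ℝ → ℝ) (D : ℕ) (C s : ℝ) :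
    iteratedDeriv (2 * D) V = fun h =>
      iteratedDeriv (2 * D) V 0 + ((C * (-1) ^ D) * |h| ^ s + remainder V D C s h) := by
  ext h; simp only [remainder]; ring

lemma neg_diff_eq (h0 : H0 V) (heven : ∀ x, V (-x) = V x) (h1 : H1 V α D C s) {b : ℤ →₀ ℝ}
    (hb : ∀ m ≤ 2 * D, ∑ j ∈ b.support, b j * (j : ℝ) ^ m = 0) (k : ℤ) {δ : ℝ} (hδ : 0 < δ) :
    -diff δ b k V = δ ^ (2 * D) * (C * (-1) ^ D * (δ ^ s * R k 1 (2 * D) (fun h => |h| ^ s) b) +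
      R k δ (2 * D) (remainder V D C s) b) := by
  have hr := continuous_remainder h0 heven h1
  have ha := (continuous_abs_rpow h1.s_pos).const_mul (C * (-1) ^ D)
  have har : Continuous fun h : ℝ => C * (-1) ^ D * |h| ^ s + remainder V D C s h := ha.add hr
  have h := R_eq_pow_mul_R_add (F := fun m => iteratedDeriv m V) (S := Set.univ) (i := k) (δ := δ)
    (q := 0) (b := b) (2 * D) (by simp)
    (fun m hm z _ => by
      rw [iteratedDeriv_succ]; exact (h1.differentiable m hm z).hasDerivAt)
    (fun m hm => by
      refine Continuous.continuousOn ?_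
      -- Derivatives below order `2D` are continuous because differentiable; the one of order `2D`
      -- is continuous by its expansion.
      rcases (Nat.succ_le_of_lt hm).lt_or_eq with h | h
      · exact (h1.differentiable _ h).continuous
      · rw [← Nat.succ_eq_add_one, h, iteratedDeriv_eq_add_remainder V D C s]
        exact continuous_const.add har)
    (fun m hm => by simpa using hb m hm.le)
  simp only [iteratedDeriv_zero, zero_add] at h
  rw [iteratedDeriv_eq_add_remainder V D C s, R_add continuous_const har, R_add ha hr,
    R_const (hb _ le_rfl), R_const_mul, R_abs_rpow k hδ, zero_add] at h
  exact h

lemma R_remainder_isLittleO (h1 : H1 V α D C s) (q : ℕ) (b : ℤ →₀ ℝ) (k : ℤ) :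
    (fun δ : ℝ => R k δ q (remainder V D C s) b) =o[𝓝[>] 0] fun δ : ℝ => δ ^ s := by
  obtain ⟨J, hJ⟩ := exists_abs_le_of_mem_support b
  -- All evaluation points lie within `A * δ` of the origin.
  set A : ℝ := |(k : ℝ)| + J + 1 with hA
  have hA0 : 0 < A := by positivity
  set B : ℝ := ∑ j ∈ b.support, |b j| * |(j : ℝ)| ^ q with hB
  have hB0 : 0 ≤ B := Finset.sum_nonneg fun _ _ => by positivity
  rw [isLittleO_iff]
  intro c hc
  -- `B + 1` instead of `B`, since `B` may be zero.
  set ε : ℝ := c / (A ^ s * (B + 1)) with hε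
  have hε0 : 0 < ε := by positivity
  obtain ⟨ρ, hρ, h⟩ := Metric.eventually_nhds_iff.1 (isLittleO_iff.1 h1.isLittleO hε0)
  have hsmall : ∀ᶠ δ : ℝ in 𝓝[>] 0, δ < ρ / A :=
    (eventually_lt_nhds (by positivity : (0 : ℝ) < ρ / A)).filter_mono nhdsWithin_le_nhds
  filter_upwards [hsmall, self_mem_nhdsWithin] with δ hδρ hδ
  replace hδ : 0 < δ := hδ
  have hδs : 0 < δ ^ s := Real.rpow_pos_of_pos hδ s
  rw [Real.norm_eq_abs, Real.norm_eq_abs, abs_of_pos hδs]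
  have hR := abs_R_le (i := k) (δ := δ) (q := q) (f := remainder V D C s) (b := b)
    (B := ε * (A ^ s * δ ^ s)) fun j hj η hη => ?_
  · refine hR.trans ?_
    rw [← hB]
    have : ε * (A ^ s * δ ^ s) * B ≤ ε * (A ^ s * δ ^ s) * (B + 1) := by
      gcongr; linarith
    refine this.trans (le_of_eq ?_)
    rw [hε]; field_simp
  · have h2 : |((k : ℝ) + j * η) * δ| ≤ A * δ := by
      rw [abs_mul, abs_of_pos hδ]
      gcongr
      have h3 : |(j : ℝ) * η| ≤ J := by
        rw [abs_mul, abs_of_nonneg hη.1]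
        have : |(j : ℝ)| ≤ J := by exact_mod_cast hJ j hj
        calc _ ≤ (J : ℝ) * 1 := mul_le_mul this hη.2 hη.1 (by positivity)
          _ = J := mul_one _
      linarith [abs_add_le (k : ℝ) (j * η)]
    have h4 : A * δ < ρ := by
      rwa [lt_div_iff₀ hA0, mul_comm] at hδρ
    have h5 := h (y := ((k : ℝ) + j * η) * δ) (by simpa using h2.trans_lt h4)
    rw [Real.norm_eq_abs, Real.norm_eq_abs, abs_of_nonneg (Real.rpow_nonneg (abs_nonneg _) _)] at h5
    refine h5.trans ?_
    rw [← Real.mul_rpow hA0.le hδ.le]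
    gcongr
    exact h1.s_pos.le

/-- Again `d` Taylor steps away from the origin: they contribute `δ^d`, and the bound on `r^(d)`
contributes `(δ |k|)^β` up to a constant. -/
lemma exists_abs_R_remainder_le (h0 : H0 V) (heven : ∀ x, V (-x) = V x) {b : ℤ →₀ ℝ} {J d : ℕ}
    (hJ : ∀ j ∈ b.support, |j| ≤ J)
    (hb : ∀ m < 2 * D + d, ∑ j ∈ b.support, b j * (j : ℝ) ^ m = 0) {β K : ℝ} (hβ : β ≤ 0)
    (hK : ∀ h : ℝ, h ≠ 0 → (α = 1 → |h| < 1) →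
      |iteratedDeriv d (remainder V D C s) h| ≤ K * |h| ^ β) :
    ∃ K', 0 ≤ K' ∧ ∀ (k : ℤ) (δ : ℝ), 0 < δ → (J : ℤ) < |k| →
      (α = 1 → ∀ j ∈ b.support, ∀ η ∈ Set.Icc (0 : ℝ) 1, |((k : ℝ) + j * η) * δ| < 1) →
      |R k δ (2 * D) (remainder V D C s) b| ≤ K' * (δ ^ (d + β) * |(k : ℝ)| ^ β) := by
  refine ⟨|K| * ((J : ℝ) + 1) ^ (-β) * ∑ j ∈ b.support, |b j| * |(j : ℝ)| ^ (2 * D + d),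
    mul_nonneg (by positivity) (Finset.sum_nonneg fun _ _ => by positivity),
    fun k δ hδ hk hα => ?_⟩
  have hne : ∀ j ∈ b.support, ∀ η ∈ Set.Icc (0 : ℝ) 1, ((k : ℝ) + j * η) * δ ≠ 0 := by
    intro j hj η hη
    have h := div_le_abs_add_mul hk (hJ j hj) hη
    have hk0 : 0 < |(k : ℝ)| := by
      have : (0 : ℤ) < |k| := by omega
      exact_mod_cast this
    exact mul_ne_zero (abs_pos.1 (lt_of_lt_of_le (by positivity) h)) hδ.ne'
  have hsm : ∀ m : ℕ, ∀ z : ℝ, z ≠ 0 →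
      DifferentiableAt ℝ (iteratedDeriv m (remainder V D C s)) z := fun m z hz =>
    (contDiffAt_iteratedDeriv (contDiffAt_remainder h0 heven hz) m).differentiableAt (by simp)
  have h := R_eq_pow_mul_R_add (F := fun m => iteratedDeriv m (remainder V D C s))
    (S := {x | x ≠ 0}) (i := k) (δ := δ) (q := 2 * D) (b := b) d hne
    (fun m hm z hz => by rw [iteratedDeriv_succ]; exact (hsm m z hz).hasDerivAt)
    (fun m hm => continuousOn_of_forall_continuousAt fun z hz => (hsm _ z hz).continuousAt)
    (fun m hm => hb _ (by omega))
  simp only [iteratedDeriv_zero] at h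
  have h2 := abs_R_le_rpow hδ hJ hk (abs_nonneg K) hβ (q := 2 * D + d)
    (f := iteratedDeriv d (remainder V D C s)) fun j hj η hη =>
      (hK _ (hne j hj η hη) fun ha => hα ha j hj η hη).trans
        (mul_le_mul_of_nonneg_right (le_abs_self K) (by positivity))
  rw [h, abs_mul, abs_of_pos (pow_pos hδ d), Real.rpow_add hδ, Real.rpow_natCast]
  calc _ ≤ δ ^ d * _ := mul_le_mul_of_nonneg_left h2 (pow_pos hδ d).le
    _ = _ := by ring

end QuadVar

namespace QuadVar

/-! ### Counting pairs of indices with a given difference -/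

/-- The number of pairs `(i, i')` with `1 ≤ i ≤ A`, `1 ≤ i' ≤ B` and `i - i' = k`. -/
def pairCount (A B : ℕ) (k : ℤ) : ℕ :=
  (((Finset.Icc 1 A) ×ˢ (Finset.Icc 1 B)).filter fun p => (p.1 : ℤ) - (p.2 : ℤ) = k).card

lemma sum_sum_eq_tsum_pairCount (A B : ℕ) (g : ℤ → ℝ) :
    ∑ i ∈ Finset.Icc 1 A, ∑ i' ∈ Finset.Icc 1 B, g ((i : ℤ) - (i' : ℤ)) =
      ∑' k : ℤ, (pairCount A B k : ℝ) * g k := by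
  rw [← Finset.sum_product' (f := fun i i' : ℕ => g ((i : ℤ) - (i' : ℤ))),
    Finset.sum_comp g fun p : ℕ × ℕ => (p.1 : ℤ) - (p.2 : ℤ), tsum_eq_sum]
  · exact Finset.sum_congr rfl fun k _ => by rw [nsmul_eq_mul]; rfl
  · intro k hk
    have : pairCount A B k = 0 := by
      rw [pairCount, Finset.card_eq_zero, Finset.filter_eq_empty_iff]
      intro p hp h
      exact hk (Finset.mem_image.2 ⟨p, hp, h⟩)
    rw [this, Nat.cast_zero, zero_mul]

lemma pairCount_le (A B : ℕ) (k : ℤ) : pairCount A B k ≤ A := by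
  have h := Finset.card_le_card_of_injOn (t := Finset.Icc 1 A) (Prod.fst : ℕ × ℕ → ℕ)
    (s := ((Finset.Icc 1 A) ×ˢ (Finset.Icc 1 B)).filter fun p => (p.1 : ℤ) - (p.2 : ℤ) = k)
    (fun p hp => by simp at hp ⊢; omega)
    (fun p hp p' hp' h => by
      simp at hp hp'
      ext <;> omega)
  simpa [pairCount] using h

/-- Each `i'` at distance at least `|k|` from both ends of `[1, min A B]` gives the pair `(i' + k,
i')`. -/
lemma le_pairCount (A B : ℕ) (k : ℤ) : min A B - 2 * k.natAbs ≤ pairCount A B k := by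
  have h := Finset.card_le_card_of_injOn
    (s := Finset.Icc (1 + k.natAbs) (min A B - k.natAbs))
    (fun i : ℕ => (((i : ℤ) + k).toNat, i))
    (t := ((Finset.Icc 1 A) ×ˢ (Finset.Icc 1 B)).filter fun p => (p.1 : ℤ) - (p.2 : ℤ) = k)
    (fun i hi => by simp at hi ⊢; omega)
    (fun i _ i' _ h => by simpa using (Prod.ext_iff.1 h).2)
  rw [Nat.card_Icc] at h
  rw [pairCount]; omega

lemma tendsto_pairCount_div (L L' : ℕ) (k : ℤ) :
    Tendsto (fun n : ℕ => (pairCount (n + 1 - (L + 1)) (n + 1 - (L' + 1)) k : ℝ) / n) atTop (𝓝 1) := by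
  have hlow : Tendsto (fun n : ℕ => 1 - ((L + L' + 2 * k.natAbs : ℕ) : ℝ) / n) atTop (𝓝 1) := by
    simpa using (tendsto_const_div_atTop_nhds_zero_nat ((L + L' + 2 * k.natAbs : ℕ) : ℝ)).const_sub 1
  refine tendsto_of_tendsto_of_tendsto_of_le_of_le' hlow tendsto_const_nhds ?_ ?_
  · filter_upwards [eventually_gt_atTop 0] with n hn
    have hn' : (0 : ℝ) < n := by exact_mod_cast hn
    have h := le_pairCount (n + 1 - (L + 1)) (n + 1 - (L' + 1)) k
    have h2 : n ≤ pairCount (n + 1 - (L + 1)) (n + 1 - (L' + 1)) k + (L + L' + 2 * k.natAbs) := by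
      omega
    have h3 : (n : ℝ) ≤ pairCount (n + 1 - (L + 1)) (n + 1 - (L' + 1)) k +
      ((L + L' + 2 * k.natAbs : ℕ) : ℝ) := by exact_mod_cast h2
    rw [le_div_iff₀ hn', sub_mul, div_mul_cancel₀ _ hn'.ne']
    linarith
  · filter_upwards [eventually_gt_atTop 0] with n hn
    have hn' : (0 : ℝ) < n := by exact_mod_cast hn
    rw [div_le_one hn']
    have := pairCount_le (n + 1 - (L + 1)) (n + 1 - (L' + 1)) k
    exact_mod_cast this.trans (by omega)

lemma exists_of_mem_support_conv {a a' : ℤ →₀ ℝ} {j : ℤ} (hj : j ∈ (conv a a').support) :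
    ∃ p ∈ a.support, ∃ l ∈ a'.support, p - l = j := by
  by_contra! h
  refine Finsupp.mem_support_iff.1 hj ?_
  rw [conv, Finsupp.finsetSum_apply]
  refine Finset.sum_eq_zero fun p hp => ?_
  rw [Finsupp.finsetSum_apply]
  exact Finset.sum_eq_zero fun l hl => Finsupp.single_eq_of_ne' (h p hp l hl)

lemma bounds_of_mem_support {a : ℤ →₀ ℝ} (ha : IsVariationSequence a) {p : ℤ} (hp : p ∈ a.support) :
    0 ≤ p ∧ p + 1 ≤ length a := by
  constructor
  · by_contra! h
    exact Finsupp.mem_support_iff.1 hp (ha.apply_neg p h)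
  · have := Finset.le_sup (f := Int.toNat) hp
    rw [length]; omega

/-- All the points at which the increments are evaluated are at mutual distance less than `n`. -/
lemma abs_add_mul_lt_of_pairCount_ne_zero {a a' : ℤ →₀ ℝ} (ha : IsVariationSequence a)
    (ha' : IsVariationSequence a') {n : ℕ} {k : ℤ}
    (hk : pairCount (n + 1 - length a) (n + 1 - length a') k ≠ 0)
    {j : ℤ} (hj : j ∈ (conv a a').support) {η : ℝ} (hη : η ∈ Set.Icc (0 : ℝ) 1) :
    |(k : ℝ) + j * η| < n := by
  obtain ⟨⟨i, i'⟩, hi⟩ := Finset.card_ne_zero.1 hk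
  simp only [Finset.mem_filter, Finset.mem_product, Finset.mem_Icc] at hi
  obtain ⟨p, hp, l, hl, rfl⟩ := exists_of_mem_support_conv hj
  have hp' := bounds_of_mem_support ha hp
  have hl' := bounds_of_mem_support ha' hl
  have h1 : k < n ∧ -(n : ℤ) < k ∧ k + (p - l) < n ∧ -(n : ℤ) < k + (p - l) := by omega
  obtain ⟨h2, h3, h4, h5⟩ := h1
  have h2' : (k : ℝ) < n := by exact_mod_cast h2
  have h3' : -(n : ℝ) < k := by exact_mod_cast h3
  have h4' : (k : ℝ) + ((p - l : ℤ) : ℝ) < n := by exact_mod_cast h4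
  have h5' : -(n : ℝ) < (k : ℝ) + ((p - l : ℤ) : ℝ) := by exact_mod_cast h5
  generalize ((p - l : ℤ) : ℝ) = y at *
  have h6 : (k : ℝ) + y * η = (1 - η) * k + η * (k + y) := by ring
  rw [h6]
  -- Both endpoints `k` and `k + y` lie in `(-n, n)`, hence so does the segment.
  have hc := convex_Ioo (-(n : ℝ)) n ⟨h3', h2'⟩ ⟨h5', h4'⟩ (sub_nonneg.2 hη.2) hη.1 (by ring)
  exact abs_lt.2 hc

end QuadVar

namespace QuadVar

/-! ### The asymptotics -/

/-- For `s ≥ 3/2` one has `s/2 + 1/4 ≥ 1`, so `M ≥ D + 2`, which leaves room for the third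
derivative. -/
lemma order_bounds {D M : ℕ} {s : ℝ} (hs : 0 < s) (hM : (D : ℝ) + s / 2 + 1 / 4 < M) :
    D + 1 ≤ M ∧ 2 * D + derivOrder s ≤ 2 * M := by
  have h1 : D < M := by
    have : (D : ℝ) < M := by linarith
    exact_mod_cast this
  refine ⟨h1, ?_⟩
  rw [derivOrder]
  split_ifs with h
  · omega
  · have : ((D + 1 : ℕ) : ℝ) < M := by push_cast; linarith
    have := Nat.cast_lt.1 this
    omega

lemma tendsto_mesh {α : ℝ} (hα : 0 < α) :
    Tendsto (fun n : ℕ => (n : ℝ) ^ (-α)) atTop (𝓝[>] 0) := by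
  refine tendsto_nhdsWithin_iff.2
    ⟨(tendsto_rpow_neg_atTop hα).comp tendsto_natCast_atTop_atTop, ?_⟩
  filter_upwards [eventually_gt_atTop 0] with n hn
  exact Real.rpow_pos_of_pos (by exact_mod_cast hn) _

lemma summable_ite_int_rpow_sq {β : ℝ} (hβ : β < -1 / 2) (K : ℝ) (J : ℕ) (g : ℤ → ℝ) :
    Summable fun k : ℤ => if |k| ≤ (J : ℤ) then g k else (K * |(k : ℝ)| ^ β) ^ 2 := by
  refine (summable_congr_cofinite ?_).1 (summable_int_rpow_sq hβ K)
  filter_upwards [(finite_abs_le J).compl_mem_cofinite] with k hk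
  rw [if_neg (by simpa using hk)]

section

variable {V : ℝ → ℝ} {α C s : ℝ} {D : ℕ} {a a' : ℤ →₀ ℝ}

/-- The tails of the limit and of the rescaled remainder are dominated by a power `β < -1/2`. -/
lemma exists_tail_bounds (hα : 0 < α) (h0 : H0 V) (heven : ∀ x, V (-x) = V x)
    (h1 : H1 V α D C s) (h2 : H2 V α D C s)
    (ha : IsVariationSequence a) (ha' : IsVariationSequence a')
    (hb : ∀ m < 2 * D + derivOrder s, ∑ j ∈ (conv a a').support, conv a a' j * (j : ℝ) ^ m = 0) :
    ∃ β : ℝ, β < -1 / 2 ∧ ∃ J : ℕ, ∃ K : ℝ,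
      (∀ k : ℤ, (J : ℤ) < |k| →
        C * |R k 1 (2 * D) (fun h => |h| ^ s) (conv a a')| ≤ K * |(k : ℝ)| ^ β) ∧
      ∃ K' : ℝ, ∀ (n : ℕ) (k : ℤ), 0 < n → (J : ℤ) < |k| →
        pairCount (n + 1 - length a) (n + 1 - length a') k ≠ 0 →
        |R k ((n : ℝ) ^ (-α)) (2 * D) (remainder V D C s) (conv a a')| /
          ((n : ℝ) ^ (-α)) ^ s ≤ K' * |(k : ℝ)| ^ β := by
  obtain ⟨β, hβ1, hβ2, K, hK⟩ := h2
  obtain ⟨J, hJ⟩ := exists_abs_le_of_mem_support (conv a a')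
  obtain ⟨K₁, hK₁⟩ := abs_R_abs_rpow_le (s := s) (by linarith) hJ hb
  obtain ⟨K₂, hK₂0, hK₂⟩ := exists_abs_R_remainder_le (α := α) (D := D) h0 heven hJ hb
    (by linarith) hK
  refine ⟨β, hβ2, J, C * |K₁|, fun k hk => ?_, K₂, fun n k hn hk hc => ?_⟩
  · have hk1 : 1 ≤ |(k : ℝ)| := by
      have : (1 : ℤ) ≤ |k| := by omega
      exact_mod_cast this
    rw [mul_assoc]
    refine mul_le_mul_of_nonneg_left ?_ h1.C_pos.le
    calc _ ≤ K₁ * |(k : ℝ)| ^ (s - derivOrder s) := hK₁ k hk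
      _ ≤ |K₁| * |(k : ℝ)| ^ (s - derivOrder s) := by gcongr; exact le_abs_self _
      _ ≤ |K₁| * |(k : ℝ)| ^ β := by
        gcongr
  · have hn0 : (0 : ℝ) < n := by exact_mod_cast hn
    have hn1 : (1 : ℝ) ≤ n := by exact_mod_cast hn
    have hδ : 0 < (n : ℝ) ^ (-α) := Real.rpow_pos_of_pos hn0 _
    -- In the infill case `δ = 1/n`, so a lag that occurs keeps all points in `|h| < 1`, where
    -- `r^(d)` is controlled.
    have h := hK₂ k _ hδ hk fun hα j hj η hη => by
      rw [hα, Real.rpow_neg_one, ← div_eq_mul_inv, abs_div, Nat.abs_cast, div_lt_one hn0]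
      exact abs_add_mul_lt_of_pairCount_ne_zero ha ha' hc hj hη
    rw [div_le_iff₀ (Real.rpow_pos_of_pos hδ s)]
    refine h.trans ?_
    have hδ1 : (n : ℝ) ^ (-α) ≤ 1 := Real.rpow_le_one_of_one_le_of_nonpos hn1 (by linarith)
    -- Here `s - d < β` is used: `δ^(d+β) ≤ δ^s` makes the bound uniform in `n`.
    have := Real.rpow_le_rpow_of_exponent_ge hδ hδ1 (by linarith : s ≤ derivOrder s + β)
    rw [mul_assoc, mul_comm (|(k : ℝ)| ^ β)]
    gcongr

lemma tendsto_tsum_pairCount (hα : 0 < α) (h0 : H0 V) (heven : ∀ x, V (-x) = V x)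
    (h1 : H1 V α D C s) (h2 : H2 V α D C s)
    (ha : IsVariationSequence a) (ha' : IsVariationSequence a')
    (hb : ∀ m < 2 * D + derivOrder s, ∑ j ∈ (conv a a').support, conv a a' j * (j : ℝ) ^ m = 0) :
    Summable (fun k : ℤ => R k 1 (2 * D) (fun h => |h| ^ s) (conv a a') ^ 2) ∧
    Tendsto (fun n : ℕ => ∑' k : ℤ,
      (pairCount (n + 1 - length a) (n + 1 - length a') k : ℝ) / n *
        (C * (-1) ^ D * R k 1 (2 * D) (fun h => |h| ^ s) (conv a a') +
          R k ((n : ℝ) ^ (-α)) (2 * D) (remainder V D C s) (conv a a') /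
            ((n : ℝ) ^ (-α)) ^ s) ^ 2) atTop
      (𝓝 (C ^ 2 * ∑' k : ℤ, R k 1 (2 * D) (fun h => |h| ^ s) (conv a a') ^ 2)) := by
  obtain ⟨β, hβ, J, K, hK, K', hK'⟩ := exists_tail_bounds hα h0 heven h1 h2 ha ha' hb
  set r : ℤ → ℝ := fun k => R k 1 (2 * D) (fun h => |h| ^ s) (conv a a') with hr
  set ρ : ℕ → ℤ → ℝ := fun n k => R k ((n : ℝ) ^ (-α)) (2 * D) (remainder V D C s) (conv a a') /
            ((n : ℝ) ^ (-α)) ^ s with hρ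
  have hsq : ∀ k, (C * (-1) ^ D * r k) ^ 2 = C ^ 2 * r k ^ 2 := fun k => by
    rw [mul_pow, mul_pow, ← pow_mul, mul_comm D, pow_mul, neg_one_sq, one_pow, mul_one]
  have habs : ∀ k, |C * (-1) ^ D * r k| = C * |r k| := fun k => by
    rw [abs_mul, abs_mul, abs_pow, abs_neg, abs_one, one_pow, mul_one, abs_of_pos h1.C_pos]
  have hρ0 : ∀ k, Tendsto (ρ · k) atTop (𝓝 0) := fun k =>
    ((R_remainder_isLittleO h1 (2 * D) (conv a a') k).comp_tendsto
      (tendsto_mesh hα)).tendsto_div_nhds_zero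
  constructor
  · have h3 : Summable fun k : ℤ => C ^ 2 * r k ^ 2 := by
      refine Summable.of_nonneg_of_le (fun k => by positivity) (fun k => ?_)
        (summable_ite_int_rpow_sq hβ K J fun k => C ^ 2 * r k ^ 2)
      split_ifs with hk
      · exact le_rfl
      · rw [← hsq, ← sq_abs, habs]
        exact pow_le_pow_left₀ (mul_nonneg h1.C_pos.le (abs_nonneg _)) (hK k (not_le.1 hk)) 2
    exact (summable_mul_left_iff (pow_ne_zero 2 h1.C_pos.ne')).1 h3
  · rw [← tsum_mul_left]
    -- The majorant is `(C |r k| + 1)²` on the finitely many `|k| ≤ J`, where eventually `|ρ n k| ≤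
    -- 1`, and the square of the tail bound elsewhere.
    refine tendsto_tsum_of_dominated_convergence
      (summable_ite_int_rpow_sq hβ (K + K') J fun k => (C * |r k| + 1) ^ 2) (fun k => ?_) ?_
    · have h3 := (tendsto_pairCount_div (length a - 1) (length a' - 1) k).mul
        (((hρ0 k).const_add (C * (-1) ^ D * r k)).pow 2)
      rw [add_zero, one_mul, hsq] at h3
      exact h3
    · have hsmall : ∀ᶠ n in atTop, ∀ k ∈ {k : ℤ | |k| ≤ J}, |ρ n k| ≤ 1 := by
        refine (Filter.eventually_all_finite (finite_abs_le J)).2 fun k _ => ?_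
        have h3 := (hρ0 k).abs
        rw [abs_zero] at h3
        exact (h3.eventually_lt_const one_pos).mono fun n hn => hn.le
      filter_upwards [hsmall, eventually_gt_atTop 0] with n hn hn0 k
      have hn' : (0 : ℝ) < n := by exact_mod_cast hn0
      have hL : 1 ≤ length a := Nat.succ_pos _
      have hc1 : (pairCount (n + 1 - length a) (n + 1 - length a') k : ℝ) / n ≤ 1 := by
        rw [div_le_one hn']
        have := pairCount_le (n + 1 - length a) (n + 1 - length a') k
        exact_mod_cast this.trans (by omega)
      have hle : ∀ B, |C * (-1) ^ D * r k + ρ n k| ≤ B →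
          (pairCount (n + 1 - length a) (n + 1 - length a') k : ℝ) / n *
            (C * (-1) ^ D * r k + ρ n k) ^ 2 ≤ B ^ 2 := fun B hB => by
        rw [← sq_abs]
        calc _ ≤ 1 * B ^ 2 := by gcongr
          _ = B ^ 2 := one_mul _
      rw [Real.norm_of_nonneg (by positivity)]
      have htri := abs_add_le (C * (-1) ^ D * r k) (ρ n k)
      rw [habs] at htri
      split_ifs with hk
      · exact hle _ (htri.trans (by have := hn k hk; linarith))
      -- A lag that does not occur has weight zero; the tail bound on `ρ` is available only for the
      -- others.
      · rcases eq_or_ne (pairCount (n + 1 - length a) (n + 1 - length a') k) 0 with h3 | h3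
        · rw [h3, Nat.cast_zero, zero_div, zero_mul]; positivity
        · refine hle _ (htri.trans ?_)
          have h4 := hK k (not_le.1 hk)
          have h5 := hK' n k hn0 (not_le.1 hk) h3
          have h6 : |ρ n k| = |R k ((n : ℝ) ^ (-α)) (2 * D) (remainder V D C s) (conv a a')| /
              ((n : ℝ) ^ (-α)) ^ s := by
            rw [hρ, abs_div, abs_of_nonneg (Real.rpow_nonneg (Real.rpow_nonneg hn'.le _) _)]
          rw [h6, add_mul]
          exact add_le_add h4 h5

end

end QuadVar

theorem mainTheorem8 {Ω : Type*} [MeasurableSpace Ω] (P : Measure Ω) [IsProbabilityMeasure P]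
    (X : ℝ → Ω → ℝ) (hGauss : IsGaussianProcess X P) (hcentered : ∀ t : ℝ, ∫ ω, X t ω ∂P = 0)
    (hstat : QuadVar.HasStationaryIncrements X P)
    (α : ℝ) (hα : 0 < α) (hα1 : α ≤ 1) (D : ℕ) (C s : ℝ)
    (h0 : QuadVar.H0 (QuadVar.semivariogram X P))
    (h1 : QuadVar.H1 (QuadVar.semivariogram X P) α D C s)
    (h2 : QuadVar.H2 (QuadVar.semivariogram X P) α D C s)
    (a a' : ℤ →₀ ℝ) (ha : QuadVar.IsVariationSequence a) (ha' : QuadVar.IsVariationSequence a')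
    (hM : (D : ℝ) + s / 2 + 1 / 4 < ((min (QuadVar.order a) (QuadVar.order a') : ℕ) : ℝ)) :
    Summable (fun i : ℤ => QuadVar.R i 1 (2 * D) (fun h => |h| ^ s) (QuadVar.conv a a') ^ 2) ∧
    (fun n : ℕ =>
        covariance (QuadVar.quadVariation X α a n) (QuadVar.quadVariation X α a' n) P)
      ~[atTop]
    (fun n : ℕ => 2 * (n : ℝ) * C ^ 2 * ((n : ℝ) ^ (-α)) ^ (4 * (D : ℝ) + 2 * s) *
      ∑' i : ℤ, QuadVar.R i 1 (2 * D) (fun h => |h| ^ s) (QuadVar.conv a a') ^ 2) := by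
  open QuadVar in
  have heven := semivariogram_neg hstat
  obtain ⟨hm1, hm2⟩ := order_bounds h1.s_pos hM
  have hd : 2 ≤ derivOrder s := by rw [derivOrder]; split_ifs <;> omega
  have hmin := min_le_left (order a) (order a')
  have hmin' := min_le_right (order a) (order a')
  have hb : ∀ m < 2 * D + derivOrder s,
      ∑ j ∈ (conv a a').support, conv a a' j * (j : ℝ) ^ m = 0 := fun m hm =>
    moment_conv_eq_zero (by omega)
  obtain ⟨hsum, hlim⟩ := tendsto_tsum_pairCount hα h0 heven h1 h2 ha ha' hb
  refine ⟨hsum, ?_⟩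
  obtain ⟨k₀, hk₀⟩ := exists_R_abs_rpow_ne_zero h1.s_pos h1.s_lt (D := D)
    (fun m hm => hb m (by omega)) (moment_conv_ne_zero (a := a) (a' := a') (by omega) (by omega))
  have hpos : 0 < ∑' i : ℤ, R i 1 (2 * D) (fun h => |h| ^ s) (conv a a') ^ 2 :=
    hsum.tsum_pos (fun _ => sq_nonneg _) k₀ (by positivity)
  have hC := h1.C_pos
  have heq := (IsEquivalent.refl (u := fun n : ℕ =>
    2 * (n : ℝ) * ((n : ℝ) ^ (-α)) ^ (4 * (D : ℝ) + 2 * s)) (l := atTop)).mul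
      ((isEquivalent_const_iff_tendsto (by positivity)).2 hlim)
  refine (heq.congr_left ?_).congr_right (Eventually.of_forall fun n => ?_)
  · filter_upwards [eventually_gt_atTop 0] with n hn
    have hn' : (0 : ℝ) < n := by exact_mod_cast hn
    have hδ : 0 < (n : ℝ) ^ (-α) := Real.rpow_pos_of_pos hn' _
    rw [covariance_quadVariation hGauss hcentered hstat ha.sum_eq_zero ha'.sum_eq_zero,
      sum_sum_eq_tsum_pairCount _ _ fun k =>
        2 * diff ((n : ℝ) ^ (-α)) (conv a a') k (semivariogram X P) ^ 2, Pi.mul_apply,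
      ← tsum_mul_left]
    refine tsum_congr fun k => ?_
    rw [← neg_sq (diff _ _ _ _), neg_diff_eq h0 heven h1 (fun m hm => hb m (by omega)) k hδ,
      -- The exponent is split so that two factors `δ^s` cancel the division inside the square.
      show 4 * (D : ℝ) + 2 * s = ((4 * D : ℕ) : ℝ) + (s + s) by push_cast; ring,
      Real.rpow_add hδ, Real.rpow_natCast, Real.rpow_add hδ]
    have hδs := (Real.rpow_pos_of_pos hδ s).ne'
    field_simp
    ring
  · simp only [Pi.mul_apply, Function.const_apply]; ring
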